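/- A $\mathsf{QAC}$ circuit is a quantum circuit built from arbitrary single-qubit unitaries and generalized Toffoli gates $|u_1,\dots,u_k\rangle|v\rangle\mapsto|u_1,\dots,u_k\rangle|v\oplus(u_1\wedge\cdots\wedge u_k)\rangle$ with $k\ge 1$. Its depth is the number of its layers, a layer being a product of gates that operate on disjoint sets of qubits; its size is the total number of its gates and qubits. A circuit $C$ with $a$ ancillas, on an input $x\in\{0,1\}^n$, outputs $b\in\{0,1\}$ with the probability that the last qubit of $C|x\rangle|0^a\rangle|0\rangle$, measured in the computational basis, gives $b$. Write $|x|$ for the Hamming weight of $x$, and $\log$ for the logarithm to base $2$. **Theorem C.1.** For all constants $c_1,c_2\in\mathbb N$ there are a constant $d$ and a polynomial $P$ such that for every $n\ge 1$ there is a $\mathsf{QAC}$ circuit of depth at most $d$ and size at most $P(n)$ which, given a single copy of $x\in\{0,1\}^n$, * outputs $1$ with probability at least $1-2^{-(\log n)^{c_1}}$ if $|x|=n/2$, and * outputs $0$ with probability at least $\min\{1,(\log n)^{c_2}/n\}$ if $|x|\ne n/2$. -/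

import Mathlib

noncomputable section

/-- The gates of a QAC circuit on a set `Q` of qubits: arbitrary single-qubit unitaries, and
generalized Toffoli gates with a nonempty set `S` of control qubits and a target `t` outside `S`. -/
inductive QACGate (Q : Type) : Type
  | single (q : Q) (U : Matrix.unitaryGroup Bool ℂ) : QACGate Q
  | toffoli (S : Finset Q) (hS : S.Nonempty) (t : Q) (ht : t ∉ S) : QACGate Q

namespace QACGate

variable {Q : Type} [Fintype Q] [DecidableEq Q]

/-- The set of qubits on which a gate operates. -/
def support : QACGate Q → Finset Q
  | single q _ => {q}
  | toffoli S _ t _ => insert t S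

/-- The action of a generalized Toffoli gate on bit strings: the target bit is replaced by its XOR
with the AND of the control bits. -/
def toffoliMap (S : Finset Q) (t : Q) (x : Q → Bool) : Q → Bool :=
  Function.update x t (xor (x t) (decide (∀ s ∈ S, x s = true)))

/-- The unitary matrix of a gate on the whole register, in the computational basis; the entry in
row `y` and column `x` is the amplitude of `y` in the image of the basis state `x`. -/
def toMatrix : QACGate Q → Matrix (Q → Bool) (Q → Bool) ℂ
  | single q U => Matrix.of fun y x =>
      if ∀ j, j ≠ q → y j = x j then (U : Matrix Bool Bool ℂ) (y q) (x q) else 0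
  | toffoli S _ t _ => Matrix.of fun y x => if y = toffoliMap S t x then 1 else 0

end QACGate

/-- A layer of a QAC circuit: finitely many gates operating on pairwise disjoint sets of qubits
(so the order in which they are listed is irrelevant). -/
structure QACLayer (Q : Type) [DecidableEq Q] : Type where
  gates : List (QACGate Q)
  disjoint : gates.Pairwise (fun g h => Disjoint g.support h.support)

/-- The unitary of a layer: the product of its gates. -/
def QACLayer.toMatrix {Q : Type} [Fintype Q] [DecidableEq Q] (L : QACLayer Q) :
    Matrix (Q → Bool) (Q → Bool) ℂ :=
  (L.gates.map QACGate.toMatrix).prod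

/-- A QAC circuit on the qubits `Q`, as its list of layers; the head of the list is applied
first. -/
structure QACCircuit (Q : Type) [DecidableEq Q] : Type where
  layers : List (QACLayer Q)

namespace QACCircuit

/-- The product `M_d ⋯ M_2 M_1` of the unitaries of the layers `[M_1, M_2, …, M_d]`. -/
def layersMatrix {Q : Type} [Fintype Q] [DecidableEq Q] :
    List (QACLayer Q) → Matrix (Q → Bool) (Q → Bool) ℂ
  | [] => 1
  | L :: Ls => layersMatrix Ls * L.toMatrix

variable {Q : Type} [Fintype Q] [DecidableEq Q]

/-- The unitary of a circuit. -/
def toMatrix (C : QACCircuit Q) : Matrix (Q → Bool) (Q → Bool) ℂ :=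
  layersMatrix C.layers

/-- The depth of a circuit: its number of layers. -/
def depth (C : QACCircuit Q) : ℕ := C.layers.length

/-- The size of a circuit: the number of its gates plus the number of its qubits. -/
def size (C : QACCircuit Q) : ℕ :=
  (C.layers.map (fun L => L.gates.length)).sum + Fintype.card Q

/-- The state obtained by running the circuit on the computational basis state `w`. -/
def run (C : QACCircuit Q) (w : Q → Bool) : (Q → Bool) → ℂ :=
  C.toMatrix.mulVec (Pi.single w 1)

end QACCircuit

/-- The register of a circuit with `n` input qubits, `a` ancillas and one output qubit. -/
abbrev QACRegister (n a : ℕ) : Type := Fin n ⊕ (Fin a ⊕ Unit)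

/-- The initial basis state `|x⟩|0^a⟩|0⟩`. -/
def QACRegister.init {n : ℕ} (a : ℕ) (x : Fin n → Bool) : QACRegister n a → Bool :=
  Sum.elim x (fun _ => false)

/-- The output qubit, which is the last one. -/
def QACRegister.out (n a : ℕ) : QACRegister n a := Sum.inr (Sum.inr ())

/-- The probability that the output qubit of `C |x⟩|0^a⟩|0⟩`, measured in the computational basis,
gives `b`. -/
def QACCircuit.outputProb {n a : ℕ} (C : QACCircuit (QACRegister n a)) (x : Fin n → Bool)
    (b : Bool) : ℝ :=
  ∑ y : QACRegister n a → Bool,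
    if y (QACRegister.out n a) = b then ‖C.run (QACRegister.init a x) y‖ ^ 2 else 0

/-- The Hamming weight of a bit string. -/
def bitWeight {n : ℕ} (x : Fin n → Bool) : ℕ :=
  (Finset.univ.filter (fun i => x i = true)).card

end

/-! The circuit accepts balanced inputs with certainty. Choose `c`, `s` with `c² + s² = 1` and put
`C = c² - s²`, where `C ^ n = 1/2`. If the bit `x i` is encoded in a qubit `c|0⟩ ± s|1⟩` with sign
`(-1)^(x i)`, the `n` encoded qubits have overlap `C ^ |x|` with the encoding of the zero string. A
reflection about a state built on `|0^n⟩`, whose overlap with the encoding does not depend on `x`,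
subtracts a constant that can be tuned to `C ^ (n/2)`. A test therefore rejects with probability `(C
^ |x| - C ^ (n/2))²`. This is zero on balanced inputs and at least `1/(16 n²)` on all others
(`exists_realizable_test`, `le_sq_pow_sub_pow`). The AND of `n · polylog n` independent tests
rejects with the required probability `(log n)^c₂ / n`.

Each test needs its own encoding of `x`, so every input bit must control `n · polylog n` qubits in
constant depth. Two devices achieve this. A single control can flip the signs of `n` encoded qubits
at once: since `C ^ n = 1/2`, the two product states involved meet at an angle of 60°, and two
reflections carry one to the other up to sign (`exists_realizable_controlled_rotation`). The
remaining polylogarithmic factor comes from exact fan-out to `r = ⌊√⌊log n⌋⌋` targets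
(`exists_realizable_fanOut`), iterated a constant number of times (`HasFanOut.iterate`).

Fan-out is parity conjugated by Hadamard gates. Parity is read from `M ≥ r ^ r` rows in states
`α|0^r⟩ + β|1^r⟩` that are all zero with probability exactly `1/2`. The OR of a column is then the
same fair bit in every column; parity imprints a sign on it, and the two resulting states are
orthogonal, so a reflection distinguishes them. All these steps are reflections about product states
or about states prepared from them, and a generalized Toffoli gate on the whole register is such a
reflection (`realizable_reflection_prodState`).

Odd `n` is served by the constant output `0`, and the finitely many small `n` by truth tables. -/

noncomputable section
set_option linter.unusedSectionVars false
open Matrix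

/-! ### Action of gates on states, inverses, and transport to larger registers. -/

namespace QACGate

variable {Q K : Type} [Fintype Q] [DecidableEq Q] [Fintype K] [DecidableEq K]

theorem single_mulVec (q : Q) (U : Matrix.unitaryGroup Bool ℂ) (ψ : (Q → Bool) → ℂ) :
    (single q U).toMatrix *ᵥ ψ =
      fun y => ∑ b, (U : Matrix Bool Bool ℂ) (y q) b * ψ (Function.update y q b) := by
  funext y
  symm
  refine Finset.sum_of_injOn (fun b => Function.update y q b) ?_ ?_ ?_ ?_
  · intro a _ b _ h
    simpa using congrFun h q
  · simp
  · intro x _ hx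
    have : ¬ ∀ j, j ≠ q → y j = x j := by
      intro h
      apply hx
      refine ⟨x q, by simp, ?_⟩
      funext j
      by_cases hj : j = q
      · subst hj; simp
      · simp [Function.update_of_ne hj, h j hj]
    simp [toMatrix, this]
  · intro b _
    have : ∀ j, j ≠ q → y j = Function.update y q b j := fun j hj => by simp [hj]
    simp only [toMatrix, Matrix.of_apply, if_pos this, Function.update_self]

theorem toffoliMap_involutive {S : Finset Q} {t : Q} (ht : t ∉ S) :
    Function.Involutive (toffoliMap S t) := by
  intro x
  have h : ∀ s ∈ S, toffoliMap S t x s = x s := fun s hs =>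
    Function.update_of_ne (fun h : s = t => ht (h ▸ hs)) _ _
  have h' : (∀ s ∈ S, toffoliMap S t x s = true) ↔ ∀ s ∈ S, x s = true :=
    forall₂_congr fun s hs => by rw [h s hs]
  rw [toffoliMap]
  simp only [h']
  simp [toffoliMap]

theorem toffoli_mulVec (S : Finset Q) (hS : S.Nonempty) (t : Q) (ht : t ∉ S)
    (ψ : (Q → Bool) → ℂ) :
    (toffoli S hS t ht).toMatrix *ᵥ ψ = fun y => ψ (toffoliMap S t y) := by
  funext y
  have h : ∀ x, y = toffoliMap S t x ↔ toffoliMap S t y = x := fun x =>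
    ((toffoliMap_involutive ht).eq_iff).symm.trans ⟨fun h => h, fun h => h⟩
  simp only [toMatrix, Matrix.mulVec, dotProduct, Matrix.of_apply, ite_mul, one_mul, zero_mul, h]
  simp

/-- The inverse gate. -/
def inv : QACGate Q → QACGate Q
  | single q U => single q U⁻¹
  | toffoli S hS t ht => toffoli S hS t ht

theorem inv_support (g : QACGate Q) : g.inv.support = g.support := by
  cases g <;> rfl

theorem inv_toMatrix (g : QACGate Q) : g.inv.toMatrix = g.toMatrixᴴ := by
  cases g with
  | single q U =>
    ext y x
    have : (∀ j, j ≠ q → x j = y j) ↔ ∀ j, j ≠ q → y j = x j :=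
      forall₂_congr fun j _ => eq_comm
    simp only [inv, toMatrix, Matrix.of_apply, Matrix.conjTranspose_apply, this]
    split_ifs
    · simp [Matrix.star_apply]
    · simp
  | toffoli S hS t ht =>
    ext y x
    have : x = toffoliMap S t y ↔ y = toffoliMap S t x := by
      rw [← (toffoliMap_involutive ht).eq_iff]; exact eq_comm
    simp only [inv, toMatrix, Matrix.of_apply, Matrix.conjTranspose_apply, this]
    split_ifs <;> simp

theorem conjTranspose_mul_self (g : QACGate Q) : g.toMatrixᴴ * g.toMatrix = 1 := by
  rw [← inv_toMatrix]
  refine Matrix.ext_of_mulVec_single fun w => ?_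
  generalize (Pi.single w 1 : (Q → Bool) → ℂ) = ψ
  rw [← Matrix.mulVec_mulVec, Matrix.one_mulVec]
  cases g with
  | single q U =>
    rw [inv, single_mulVec, single_mulVec]
    funext y
    have hU := Matrix.mem_unitaryGroup_iff'.1 U.2
    have : ∀ c, ∑ b, (U⁻¹ : Matrix.unitaryGroup Bool ℂ).1 (y q) b * U.1 b c
        = (1 : Matrix Bool Bool ℂ) (y q) c := by
      intro c
      rw [← hU, Matrix.mul_apply]
      rfl
    simp only [Function.update_self, Function.update_idem, Finset.mul_sum, ← mul_assoc]
    rw [Finset.sum_comm]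
    simp only [← Finset.sum_mul, this, Matrix.one_apply, ite_mul, one_mul, zero_mul]
    simp
  | toffoli S hS t ht =>
    rw [inv, toffoli_mulVec, toffoli_mulVec]
    funext y
    exact congrArg ψ (toffoliMap_involutive ht y)

/-- The gate transported along an injection of registers. -/
def map (e : K → Q) (he : Function.Injective e) : QACGate K → QACGate Q
  | single q U => single (e q) U
  | toffoli S hS t ht => toffoli (S.map ⟨e, he⟩) (hS.map) (e t) (by
      simpa [he.eq_iff] using ht)

theorem support_map (e : K → Q) (he : Function.Injective e) (g : QACGate K) :
    (g.map e he).support = g.support.map ⟨e, he⟩ := by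
  cases g <;> simp [map, support, Finset.map_insert]

theorem support_nonempty (g : QACGate K) : g.support.Nonempty := by
  cases g <;> simp [support]

/-- Tensor products are expressed by a factor `r` that ignores the qubits in the range of `e`; the
gate then sees only the factor `ψ`. -/
theorem map_mulVec (e : K → Q) (he : Function.Injective e) (g : QACGate K)
    (ψ : (K → Bool) → ℂ) (r : (Q → Bool) → ℂ)
    (hr : ∀ w k b, r (Function.update w (e k) b) = r w) :
    (g.map e he).toMatrix *ᵥ (fun w => ψ (w ∘ e) * r w) =
      fun w => (g.toMatrix *ᵥ ψ) (w ∘ e) * r w := by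
  cases g with
  | single q U =>
    rw [map, single_mulVec, single_mulVec]
    funext y
    simp only [hr, Finset.sum_mul, mul_assoc, Function.comp_apply]
    simp only [Function.update_comp_eq_of_injective _ he]
  | toffoli S hS t ht =>
    rw [map, toffoli_mulVec, toffoli_mulVec]
    funext y
    simp only [toffoliMap, hr]
    rw [Function.update_comp_eq_of_injective _ he]
    congr 3
    simp

end QACGate

/-! ### Matrices of circuits of given depth. -/

section Realizable

variable {Q K : Type} [Fintype Q] [DecidableEq Q] [Fintype K] [DecidableEq K]

theorem QACLayer.conjTranspose_mul_self (L : QACLayer Q) : L.toMatrixᴴ * L.toMatrix = 1 := by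
  rw [QACLayer.toMatrix]
  generalize L.gates = gs
  induction gs with
  | nil => simp
  | cons g gs ih =>
    rw [List.map_cons, List.prod_cons, Matrix.conjTranspose_mul, Matrix.mul_assoc,
      ← Matrix.mul_assoc g.toMatrixᴴ, g.conjTranspose_mul_self, Matrix.one_mul, ih]

/-- The layer of the inverse gates. -/
def QACLayer.inv (L : QACLayer Q) : QACLayer Q where
  gates := (L.gates.map QACGate.inv).reverse
  disjoint := by
    rw [List.pairwise_reverse, List.pairwise_map]
    exact L.disjoint.imp fun h => by simpa only [QACGate.inv_support] using h.symm

theorem QACLayer.inv_toMatrix (L : QACLayer Q) : L.inv.toMatrix = L.toMatrixᴴ := by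
  have h : L.inv.gates = (L.gates.map QACGate.inv).reverse := rfl
  rw [QACLayer.toMatrix, QACLayer.toMatrix, h]
  generalize L.gates = gs
  induction gs with
  | nil => simp
  | cons g gs ih =>
    simp only [List.map_cons, List.reverse_cons, List.map_append, List.prod_append,
      List.prod_cons, Matrix.conjTranspose_mul, List.map_nil, List.prod_nil, mul_one,
      QACGate.inv_toMatrix] at ih ⊢
    rw [ih]

/-- Supports are nonempty and pairwise disjoint. Hence size is controlled by depth and number of
qubits, and gates need never be counted. -/
theorem QACLayer.gates_length_le (L : QACLayer Q) : L.gates.length ≤ Fintype.card Q := by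
  have : ∀ gs : List (QACGate Q), gs.Pairwise (fun g h => Disjoint g.support h.support) →
      ∃ A : Finset Q, gs.length ≤ A.card ∧ ∀ q ∈ A, ∃ g ∈ gs, q ∈ g.support := by
    intro gs
    induction gs with
    | nil => exact fun _ => ⟨∅, by simp⟩
    | cons g gs ih =>
      intro h
      rw [List.pairwise_cons] at h
      obtain ⟨A, hA, hA'⟩ := ih h.2
      refine ⟨g.support ∪ A, ?_, ?_⟩
      · have hd : Disjoint g.support A := by
          rw [Finset.disjoint_left]
          intro q hq hqA
          obtain ⟨g', hg', hq'⟩ := hA' q hqA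
          exact Finset.disjoint_left.1 (h.1 g' hg') hq hq'
        rw [Finset.card_union_of_disjoint hd, List.length_cons]
        have := Finset.card_pos.2 g.support_nonempty
        omega
      · intro q hq
        rcases Finset.mem_union.1 hq with hq | hq
        · exact ⟨g, by simp, hq⟩
        · obtain ⟨g', hg', hq'⟩ := hA' q hq
          exact ⟨g', by simp [hg'], hq'⟩
  obtain ⟨A, hA, -⟩ := this L.gates L.disjoint
  exact hA.trans (Finset.card_le_univ A)

/-- The matrices of the QAC circuits with `d` layers. -/
def Realizable : ℕ → Matrix (Q → Bool) (Q → Bool) ℂ → Prop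
  | 0, M => M = 1
  | d + 1, M => ∃ (L : QACLayer Q) (M' : _), Realizable d M' ∧ M = M' * L.toMatrix

namespace Realizable

theorem exists_layers {d : ℕ} {M : Matrix (Q → Bool) (Q → Bool) ℂ} (h : Realizable d M) :
    ∃ Ls : List (QACLayer Q), Ls.length = d ∧ QACCircuit.layersMatrix Ls = M := by
  induction d generalizing M with
  | zero => exact ⟨[], rfl, Eq.symm h⟩
  | succ d ih =>
    obtain ⟨L, M', h', rfl⟩ := h
    obtain ⟨Ls, rfl, rfl⟩ := ih h'
    exact ⟨L :: Ls, rfl, rfl⟩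

theorem succ {d : ℕ} {M : Matrix (Q → Bool) (Q → Bool) ℂ} (h : Realizable d M) :
    Realizable (d + 1) M := by
  induction d generalizing M with
  | zero => exact ⟨⟨[], List.Pairwise.nil⟩, M, h, by simp [QACLayer.toMatrix]⟩
  | succ d ih =>
    obtain ⟨L, M', h', rfl⟩ := h
    exact ⟨L, M', ih h', rfl⟩

theorem mono {d d' : ℕ} {M : Matrix (Q → Bool) (Q → Bool) ℂ} (h : Realizable d M) (hd : d ≤ d') :
    Realizable d' M := by
  induction hd with
  | refl => exact h
  | step _ ih => exact ih.succ

theorem one (d : ℕ) : Realizable d (1 : Matrix (Q → Bool) (Q → Bool) ℂ) :=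
  mono (d := 0) rfl (Nat.zero_le d)

theorem layer (L : QACLayer Q) : Realizable 1 L.toMatrix :=
  ⟨L, 1, rfl, (one_mul _).symm⟩

theorem gate (g : QACGate Q) : Realizable 1 g.toMatrix := by
  simpa [QACLayer.toMatrix] using layer ⟨[g], List.pairwise_singleton _ _⟩

theorem mul {d₁ d₂ : ℕ} {M₁ M₂ : Matrix (Q → Bool) (Q → Bool) ℂ} (h₂ : Realizable d₂ M₂)
    (h₁ : Realizable d₁ M₁) : Realizable (d₂ + d₁) (M₂ * M₁) := by
  induction d₁ generalizing M₁ with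
  | zero => rw [show M₁ = 1 from h₁, mul_one]; exact h₂
  | succ d ih =>
    obtain ⟨L, M', h', rfl⟩ := h₁
    exact ⟨L, M₂ * M', ih h', by rw [mul_assoc]⟩

theorem conjTranspose_mul_self {d : ℕ} {M : Matrix (Q → Bool) (Q → Bool) ℂ}
    (h : Realizable d M) : Mᴴ * M = 1 := by
  induction d generalizing M with
  | zero => rw [show M = 1 from h]; simp
  | succ d ih =>
    obtain ⟨L, M', h', rfl⟩ := h
    rw [Matrix.conjTranspose_mul, Matrix.mul_assoc, ← Matrix.mul_assoc M'ᴴ, ih h', one_mul,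
      L.conjTranspose_mul_self]

theorem mul_conjTranspose_self {d : ℕ} {M : Matrix (Q → Bool) (Q → Bool) ℂ}
    (h : Realizable d M) : M * Mᴴ = 1 :=
  mul_eq_one_comm.1 h.conjTranspose_mul_self

theorem conjTranspose {d : ℕ} {M : Matrix (Q → Bool) (Q → Bool) ℂ}
    (h : Realizable d M) : Realizable d Mᴴ := by
  induction d generalizing M with
  | zero => rw [show M = 1 from h, Matrix.conjTranspose_one]; exact one 0
  | succ d ih =>
    obtain ⟨L, M', h', rfl⟩ := h
    rw [Matrix.conjTranspose_mul, ← L.inv_toMatrix, add_comm]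
    exact (layer L.inv).mul (ih h')

theorem dotProduct_mulVec {d : ℕ} {M : Matrix (Q → Bool) (Q → Bool) ℂ} (h : Realizable d M)
    (φ ψ : (Q → Bool) → ℂ) : star (M *ᵥ φ) ⬝ᵥ (M *ᵥ ψ) = star φ ⬝ᵥ ψ := by
  rw [Matrix.star_mulVec, Matrix.dotProduct_mulVec, Matrix.vecMul_vecMul,
    h.conjTranspose_mul_self, Matrix.vecMul_one]

theorem conjTranspose_mulVec {d : ℕ} {M : Matrix (Q → Bool) (Q → Bool) ℂ} (h : Realizable d M)
    {φ ψ : (Q → Bool) → ℂ} (hM : M *ᵥ φ = ψ) : Mᴴ *ᵥ ψ = φ := by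
  rw [← hM, Matrix.mulVec_mulVec, h.conjTranspose_mul_self, Matrix.one_mulVec]

end Realizable

end Realizable

/-! ### Parallel composition on disjoint blocks of qubits. -/

section Parallel

variable {Q β : Type} {K : β → Type} [Fintype Q] [DecidableEq Q] [Fintype β] [DecidableEq β]
  [∀ b, Fintype (K b)] [∀ b, DecidableEq (K b)]

/-- `N` acts on the blocks of qubits embedded by `e` as the tensor product of the `M b`. -/
def ActsOnBlocks (e : ∀ b, K b → Q) (M : ∀ b, Matrix (K b → Bool) (K b → Bool) ℂ)
    (N : Matrix (Q → Bool) (Q → Bool) ℂ) : Prop :=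
  ∀ (ψ : ∀ b, (K b → Bool) → ℂ) (r : (Q → Bool) → ℂ),
    (∀ w b k c, r (Function.update w (e b k) c) = r w) →
    N *ᵥ (fun w => (∏ b, ψ b (w ∘ e b)) * r w) = fun w => (∏ b, (M b *ᵥ ψ b) (w ∘ e b)) * r w

namespace ActsOnBlocks

theorem one (e : ∀ b, K b → Q) : ActsOnBlocks e 1 1 := by
  intro ψ r _
  simp

theorem mul {e : ∀ b, K b → Q} {M M' : ∀ b, Matrix (K b → Bool) (K b → Bool) ℂ}
    {N N' : Matrix (Q → Bool) (Q → Bool) ℂ} (h : ActsOnBlocks e M N) (h' : ActsOnBlocks e M' N') :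
    ActsOnBlocks e (M * M') (N * N') := by
  intro ψ r hr
  rw [← Matrix.mulVec_mulVec, h' ψ r hr, h _ r hr]
  simp

theorem gate (e : ∀ b, K b → Q) (he : Function.Injective fun p : Σ b, K b => e p.1 p.2)
    (heb : ∀ b, Function.Injective (e b)) (b₀ : β) (g : QACGate (K b₀)) :
    ActsOnBlocks e (Pi.mulSingle b₀ g.toMatrix) (g.map (e b₀) (heb b₀)).toMatrix := by
  intro ψ r hr
  have h1 : (fun w => (∏ b, ψ b (w ∘ e b)) * r w) = fun w : Q → Bool => ψ b₀ (w ∘ e b₀) *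
      ((∏ b ∈ Finset.univ.erase b₀, ψ b (w ∘ e b)) * r w) := by
    funext w
    rw [← mul_assoc, Finset.mul_prod_erase _ (fun b => ψ b (w ∘ e b)) (Finset.mem_univ b₀)]
  rw [h1, QACGate.map_mulVec]
  · funext w
    rw [← Finset.mul_prod_erase _ _ (Finset.mem_univ b₀), mul_assoc, Pi.mulSingle_eq_same]
    congr 2
    refine Finset.prod_congr rfl fun b hb => ?_
    rw [Pi.mulSingle_eq_of_ne (Finset.ne_of_mem_erase hb), Matrix.one_mulVec]
  · intro w k c
    rw [hr]
    congr 1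
    refine Finset.prod_congr rfl fun b hb => ?_
    congr 1
    funext k'
    refine Function.update_of_ne (fun h => ?_) _ _
    have := he (a₁ := ⟨b, k'⟩) (a₂ := ⟨b₀, k⟩) h
    exact Finset.ne_of_mem_erase hb (Sigma.mk.inj_iff.1 this).1

/-- The gate lists of the blocks are concatenated. Injectivity of `e` on the whole sigma type keeps
gates from different blocks disjoint, so the result is still one layer. -/
theorem exists_layer (e : ∀ b, K b → Q) (he : Function.Injective fun p : Σ b, K b => e p.1 p.2)
    (L : ∀ b, QACLayer (K b)) :
    ∃ L' : QACLayer Q, ActsOnBlocks e (fun b => (L b).toMatrix) L'.toMatrix := by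
  have heb : ∀ b, Function.Injective (e b) := fun b k k' h => by
    simpa using he (a₁ := ⟨b, k⟩) (a₂ := ⟨b, k'⟩) h
  have key : ∀ l : List β, l.Nodup → ∃ L' : QACLayer Q,
      L'.gates = l.flatMap (fun b => (L b).gates.map (QACGate.map (e b) (heb b))) ∧
      ActsOnBlocks e (fun b => if b ∈ l then (L b).toMatrix else 1) L'.toMatrix := by
    intro l
    induction l with
    | nil =>
      intro _
      exact ⟨⟨[], List.Pairwise.nil⟩, rfl, by simpa [QACLayer.toMatrix, ← Pi.one_def] using one e⟩
    | cons b₀ l ih =>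
      intro hl
      rw [List.nodup_cons] at hl
      obtain ⟨L', hL', hL⟩ := ih hl.2
      refine ⟨⟨(L b₀).gates.map (QACGate.map (e b₀) (heb b₀)) ++ L'.gates, ?_⟩, by
        simp [hL'], ?_⟩
      · rw [List.pairwise_append]
        refine ⟨?_, L'.disjoint, ?_⟩
        · rw [List.pairwise_map]
          refine (L b₀).disjoint.imp fun h => ?_
          rwa [QACGate.support_map, QACGate.support_map, Finset.disjoint_map]
        · intro g hg g' hg'
          obtain ⟨g, -, rfl⟩ := List.mem_map.1 hg
          rw [hL'] at hg'
          obtain ⟨b, hb, hg'⟩ := List.mem_flatMap.1 hg'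
          obtain ⟨g', -, rfl⟩ := List.mem_map.1 hg'
          rw [QACGate.support_map, QACGate.support_map, Finset.disjoint_left]
          intro q hq hq'
          obtain ⟨k, -, rfl⟩ := Finset.mem_map.1 hq
          obtain ⟨k', -, hk⟩ := Finset.mem_map.1 hq'
          have := he (a₁ := ⟨b, k'⟩) (a₂ := ⟨b₀, k⟩) hk
          have hbb := (Sigma.mk.inj_iff.1 this).1
          exact hl.1 (hbb ▸ hb)
      · have h1 : ∀ gs : List (QACGate (K b₀)),
            ActsOnBlocks e (Pi.mulSingle b₀ (gs.map QACGate.toMatrix).prod)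
              ((gs.map (QACGate.map (e b₀) (heb b₀))).map QACGate.toMatrix).prod := by
          intro gs
          induction gs with
          | nil => simpa using one e
          | cons g gs ih =>
            simp only [List.map_cons, List.prod_cons, Pi.mulSingle_mul]
            exact (gate e he heb b₀ g).mul ih
        have h2 := (h1 (L b₀).gates).mul hL
        have h3 : (fun b => if b ∈ b₀ :: l then (L b).toMatrix else 1) =
            Pi.mulSingle b₀ ((L b₀).gates.map QACGate.toMatrix).prod *
              fun b => if b ∈ l then (L b).toMatrix else 1 := by
          funext b
          by_cases hb : b = b₀
          · subst hb
            simp [hl.1, QACLayer.toMatrix]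
          · simp [hb]
        rw [h3]
        simpa only [QACLayer.toMatrix, List.map_append, List.prod_append] using h2
  obtain ⟨L', -, h⟩ := key Finset.univ.toList (Finset.nodup_toList _)
  exact ⟨L', by simpa using h⟩

/-- Circuits on disjoint blocks of qubits can be run in parallel. -/
theorem exists_realizable {d : ℕ} (e : ∀ b, K b → Q)
    (he : Function.Injective fun p : Σ b, K b => e p.1 p.2)
    {M : ∀ b, Matrix (K b → Bool) (K b → Bool) ℂ} (hM : ∀ b, Realizable d (M b)) :
    ∃ N : Matrix (Q → Bool) (Q → Bool) ℂ, Realizable d N ∧ ActsOnBlocks e M N := by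
  induction d generalizing M with
  | zero =>
    obtain rfl : M = 1 := funext hM
    exact ⟨1, rfl, one e⟩
  | succ d ih =>
    choose L M' hM' hM using hM
    obtain ⟨N', hN', h'⟩ := ih hM'
    obtain ⟨L', hL'⟩ := exists_layer e he L
    refine ⟨N' * L'.toMatrix, ⟨L', N', hN', rfl⟩, ?_⟩
    have : M = M' * fun b => (L b).toMatrix := funext hM
    rw [this]
    exact h'.mul hL'

end ActsOnBlocks

end Parallel

/-! ### Product states and reflections about them. -/

section States

variable {Q : Type} [Fintype Q] [DecidableEq Q]

/-- The product of the single-qubit states `χ q`. -/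
def prodState (χ : Q → Bool → ℂ) : (Q → Bool) → ℂ := fun w => ∏ q, χ q (w q)

theorem single_eq_prodState (u : Q → Bool) :
    (Pi.single u 1 : (Q → Bool) → ℂ) = prodState fun q => Pi.single (u q) 1 := by
  funext w
  simp only [prodState, Pi.single_apply, Finset.prod_ite_zero, Finset.prod_const_one,
    funext_iff, Finset.mem_univ, true_imp_iff]

theorem sum_prod_eq (f : Q → Bool → ℂ) : ∑ w : Q → Bool, ∏ q, f q (w q) = ∏ q, ∑ b, f q b := by
  rw [Finset.prod_univ_sum, Fintype.piFinset_univ]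

theorem star_prodState_dotProduct (χ ψ : Q → Bool → ℂ) :
    star (prodState χ) ⬝ᵥ prodState ψ = ∏ q, star (χ q) ⬝ᵥ ψ q := by
  simp only [dotProduct, prodState, Pi.star_apply, star_prod, ← Finset.prod_mul_distrib]
  exact sum_prod_eq fun q b => star (χ q b) * ψ q b

/-- The reflection `1 - 2|χ⟩⟨χ|`. -/
def reflection (χ : (Q → Bool) → ℂ) : Matrix (Q → Bool) (Q → Bool) ℂ :=
  1 - (2 : ℂ) • Matrix.vecMulVec χ (star χ)

theorem reflection_mulVec (χ ψ : (Q → Bool) → ℂ) :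
    reflection χ *ᵥ ψ = ψ - (2 * (star χ ⬝ᵥ ψ)) • χ := by
  rw [reflection, Matrix.sub_mulVec, Matrix.one_mulVec, Matrix.smul_mulVec,
    Matrix.vecMulVec_mulVec]
  congr 1
  funext w
  simp [mul_comm, mul_left_comm]

theorem Realizable.reflection_mulVec_eq {d : ℕ} {M : Matrix (Q → Bool) (Q → Bool) ℂ}
    (h : Realizable d M) (χ : (Q → Bool) → ℂ) :
    reflection (M *ᵥ χ) = M * reflection χ * Mᴴ := by
  rw [reflection, reflection, Matrix.mul_sub, Matrix.sub_mul, mul_one, h.mul_conjTranspose_self,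
    Matrix.star_mulVec, Matrix.mul_smul, Matrix.smul_mul, Matrix.mul_vecMulVec,
    Matrix.vecMulVec_mul]

/-- Conjugating by the circuit that prepares `φ` from `χ` moves the reflection from `χ` to `φ`. -/
theorem Realizable.reflection_mulVec {d d' : ℕ} {M : Matrix (Q → Bool) (Q → Bool) ℂ}
    (h : Realizable d M) {χ φ : (Q → Bool) → ℂ} (hχ : Realizable d' (reflection χ))
    (hφ : M *ᵥ χ = φ) : Realizable (d + d' + d) (reflection φ) := by
  rw [← hφ, h.reflection_mulVec_eq]
  exact (h.mul hχ).mul h.conjTranspose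

theorem exists_unitary_mulVec {u v : Bool → ℂ} (hu : star u ⬝ᵥ u = 1) (hv : star v ⬝ᵥ v = 1) :
    ∃ U : Matrix.unitaryGroup Bool ℂ, (U : Matrix Bool Bool ℂ) *ᵥ u = v := by
  have key : ∀ u : Bool → ℂ, star u ⬝ᵥ u = 1 → ∃ U : Matrix.unitaryGroup Bool ℂ,
      (U : Matrix Bool Bool ℂ) *ᵥ u = Pi.single true 1 := by
    intro u hu
    simp only [dotProduct, Fintype.sum_bool, Pi.star_apply] at hu
    -- Row `true` is the conjugate of `u`; row `false` annihilates `u`.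
    refine ⟨⟨Matrix.of fun i j => if i then star (u j) else if j then - u false else u true,
      ?_⟩, ?_⟩
    · rw [Matrix.mem_unitaryGroup_iff]
      ext i j
      cases i <;> cases j <;> simp [Matrix.mul_apply, Matrix.star_apply] <;>
        simp at hu <;> first | ring1 | linear_combination hu
    · funext i
      cases i <;> simp [Matrix.mulVec, dotProduct]
      · ring
      · simpa using hu
  obtain ⟨U, hU⟩ := key u hu
  obtain ⟨V, hV⟩ := key v hv
  refine ⟨V⁻¹ * U, ?_⟩
  rw [Submonoid.coe_mul, ← Matrix.mulVec_mulVec, hU, ← hV, Matrix.mulVec_mulVec,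
    ← Submonoid.coe_mul, inv_mul_cancel]
  simp

/-- A layer of single-qubit unitaries. -/
theorem exists_realizable_unitaries (U : Q → Matrix.unitaryGroup Bool ℂ) :
    ∃ N : Matrix (Q → Bool) (Q → Bool) ℂ, Realizable 1 N ∧
      ∀ χ : Q → Bool → ℂ, N *ᵥ prodState χ =
        prodState fun q => (U q : Matrix Bool Bool ℂ) *ᵥ χ q := by
  obtain ⟨N, hN, h⟩ := ActsOnBlocks.exists_realizable (K := fun _ : Q => Unit) (fun q _ => q)
    (fun p p' h => by cases p; cases p'; cases h; rfl)
    (M := fun q => (QACGate.single () (U q)).toMatrix) fun q => Realizable.gate _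
  refine ⟨N, hN, fun χ => ?_⟩
  have := h (fun q v => χ q (v ())) 1 (fun _ _ _ _ => rfl)
  simp only [QACGate.single_mulVec, Pi.one_apply, mul_one, Function.comp_apply,
    Function.update_self] at this
  exact this

theorem exists_realizable_prodState {χ ψ : Q → Bool → ℂ} (hχ : ∀ q, star (χ q) ⬝ᵥ χ q = 1)
    (hψ : ∀ q, star (ψ q) ⬝ᵥ ψ q = 1) :
    ∃ N : Matrix (Q → Bool) (Q → Bool) ℂ, Realizable 1 N ∧
      N *ᵥ prodState χ = prodState ψ := by
  choose U hU using fun q => exists_unitary_mulVec (hχ q) (hψ q)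
  obtain ⟨N, hN, h⟩ := exists_realizable_unitaries U
  exact ⟨N, hN, by simp only [h, hU]⟩

/-- A generalized Toffoli gate is the reflection about a product state, hence so are its conjugates
by single-qubit unitaries. -/
theorem realizable_reflection_prodState [Nontrivial Q] {χ : Q → Bool → ℂ}
    (hχ : ∀ q, star (χ q) ⬝ᵥ χ q = 1) : Realizable 3 (reflection (prodState χ)) := by
  obtain ⟨t, t', htt⟩ := exists_pair_ne Q
  set S : Finset Q := Finset.univ.erase t with hS
  have hSne : S.Nonempty := ⟨t', by simp [hS, htt.symm]⟩
  have htS : t ∉ S := by simp [hS]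
  obtain ⟨κ, hsq⟩ : ∃ κ : ℝ, (κ : ℂ) * κ = 1 / 2 := by
    refine ⟨√(1 / 2), ?_⟩
    rw [← Complex.ofReal_mul, Real.mul_self_sqrt (by norm_num)]
    norm_num
  -- `|1⟩` on the controls and `(|0⟩ - |1⟩)/√2` on the target: the only direction that the Toffoli
  -- gate negates, all orthogonal states being fixed.
  set ξ : Q → Bool → ℂ := fun q b => if q = t then (if b then -1 else 1) * κ
    else if b then 1 else 0 with hξ
  have hξ1 : ∀ q, star (ξ q) ⬝ᵥ ξ q = 1 := by
    intro q
    by_cases hq : q = t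
    · simp only [dotProduct, Fintype.sum_bool, Pi.star_apply, hξ, hq]
      simp only [if_true, Bool.false_eq_true, if_false, RCLike.star_def, map_mul, map_neg, map_one,
        Complex.conj_ofReal]
      linear_combination 2 * hsq
    · simp [dotProduct, hξ, hq]
  have hT : (QACGate.toffoli S hSne t htS).toMatrix = reflection (prodState ξ) := by
    refine Matrix.ext_of_mulVec_single fun u => ?_
    rw [QACGate.toffoli_mulVec, reflection_mulVec]
    funext w
    have hval : ∀ w : Q → Bool, prodState ξ w = if ∀ s ∈ S, w s = true then
        (if w t then -1 else 1) * (κ : ℂ) else 0 := by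
      intro w
      rw [prodState, ← Finset.mul_prod_erase _ _ (Finset.mem_univ t), ← hS]
      have : ∏ q ∈ S, ξ q (w q) = ∏ q ∈ S, if w q = true then 1 else 0 :=
        Finset.prod_congr rfl fun q hq => by simp [hξ, Finset.ne_of_mem_erase hq]
      rw [this, Finset.prod_ite_zero]
      simp [hξ]
    have hext : ∀ v v' : Q → Bool, (∀ s ∈ S, v s = true) → (∀ s ∈ S, v' s = true) →
        (v = v' ↔ v t = v' t) := by
      intro v v' hv hv'
      refine ⟨fun h => h ▸ rfl, fun h => funext fun q => ?_⟩
      by_cases hq : q = t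
      · rw [hq, h]
      · have : q ∈ S := by simp [hS, hq]
        rw [hv q this, hv' q this]
    have hoff : ∀ s ∈ S, QACGate.toffoliMap S t w s = w s := fun s hs =>
      Function.update_of_ne (fun h : s = t => htS (h ▸ hs)) _ _
    simp only [dotProduct_single, mul_one, Pi.star_apply, Pi.sub_apply, Pi.smul_apply, smul_eq_mul,
      Pi.single_apply, hval]
    by_cases hw : ∀ s ∈ S, w s = true
    · by_cases hu : ∀ s ∈ S, u s = true
      · have hTw : ∀ s ∈ S, QACGate.toffoliMap S t w s = true := fun s hs => by
          rw [hoff s hs, hw s hs]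
        have hTt : QACGate.toffoliMap S t w t = !(w t) := by
          rw [QACGate.toffoliMap, Function.update_self, decide_eq_true hw, Bool.xor_true]
        simp only [if_pos hw, if_pos hu, hext _ _ hTw hu, hext _ _ hw hu, hTt]
        rcases w t <;> rcases u t <;> simp <;>
          first | linear_combination (-2) * hsq | linear_combination 2 * hsq
      · have h1 : QACGate.toffoliMap S t w ≠ u := by
          rintro rfl
          exact hu fun s hs => by rw [hoff s hs, hw s hs]
        have h2 : w ≠ u := by
          rintro rfl
          exact hu hw
        simp [hu, h1, h2]
    · have : QACGate.toffoliMap S t w = w := by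
        simp [QACGate.toffoliMap, hw]
      simp [hw, this]
  have h3 : Realizable 1 (reflection (prodState ξ)) := hT ▸ Realizable.gate _
  obtain ⟨N, hN, h⟩ := exists_realizable_prodState hξ1 hχ
  exact hN.reflection_mulVec h3 h

end States

/-! ### Block actions on basis states and diagonal block actions. -/

section Blocks

variable {Q β : Type} {K : β → Type} [Fintype Q] [DecidableEq Q] [Fintype β] [DecidableEq β]
  [∀ b, Fintype (K b)] [∀ b, DecidableEq (K b)] {e : ∀ b, K b → Q}
  {M : ∀ b, Matrix (K b → Bool) (K b → Bool) ℂ} {N : Matrix (Q → Bool) (Q → Bool) ℂ}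

namespace ActsOnBlocks

theorem mulVec_single (h : ActsOnBlocks e M N) (u : Q → Bool) :
    N *ᵥ Pi.single u 1 = fun w => (∏ b, (M b *ᵥ Pi.single (u ∘ e b) 1) (w ∘ e b)) *
      if ∀ q, (∀ b k, e b k ≠ q) → w q = u q then 1 else 0 := by
  classical
  rw [← h]
  · congr 1
    funext w
    simp only [Pi.single_apply, Finset.prod_ite_zero, Finset.prod_const_one, Finset.mem_univ,
      true_imp_iff, ite_mul, zero_mul, one_mul, ← ite_and]
    congr 1
    rw [eq_iff_iff]
    constructor
    · rintro rfl
      simp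
    · rintro ⟨h1, h2⟩
      funext q
      by_cases hq : ∃ b k, e b k = q
      · obtain ⟨b, k, rfl⟩ := hq
        exact congrFun (h1 b) k
      · push Not at hq
        exact h2 q hq
  · intro w b k c
    congr 1
    rw [eq_iff_iff]
    refine forall₂_congr fun q hq => ?_
    rw [Function.update_of_ne (hq b k).symm]

theorem mulVec_single_eq_single (h : ActsOnBlocks e M N) {u u' : Q → Bool}
    (hM : ∀ b, M b *ᵥ Pi.single (u ∘ e b) 1 = Pi.single (u' ∘ e b) 1)
    (hu : ∀ q, (∀ b k, e b k ≠ q) → u' q = u q) :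
    N *ᵥ Pi.single u 1 = Pi.single u' 1 := by
  rw [h.mulVec_single]
  funext w
  simp only [hM, Pi.single_apply, Finset.prod_ite_zero, Finset.prod_const_one, Finset.mem_univ,
    true_imp_iff, mul_ite, mul_one, mul_zero, ← ite_and]
  congr 1
  rw [eq_iff_iff]
  constructor
  · rintro ⟨h2, h1⟩
    funext q
    by_cases hq : ∃ b k, e b k = q
    · obtain ⟨b, k, rfl⟩ := hq
      exact congrFun (h1 b) k
    · push Not at hq
      rw [h2 q hq, hu q hq]
  · rintro rfl
    exact ⟨fun q hq => hu q hq, fun b => rfl⟩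

/-- The defining property of `ActsOnBlocks` concerns product states only. Phases on basis states
determine the operator, so here `ψ` may be entangled across the blocks. -/
theorem mulVec_of_diagonal (h : ActsOnBlocks e M N) {s : ∀ b, (K b → Bool) → ℂ}
    (hM : ∀ b v, M b *ᵥ Pi.single v 1 = s b v • Pi.single v 1) (ψ : (Q → Bool) → ℂ) :
    N *ᵥ ψ = fun w => (∏ b, s b (w ∘ e b)) * ψ w := by
  have hN : N = Matrix.diagonal fun w => ∏ b, s b (w ∘ e b) := by
    refine Matrix.ext_of_mulVec_single fun u => ?_
    rw [h.mulVec_single]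
    funext w
    rw [Matrix.mulVec_diagonal]
    simp only [hM, Pi.smul_apply, smul_eq_mul]
    by_cases hw : w = u
    · subst hw
      simp
    · rw [Pi.single_eq_of_ne hw, mul_zero, mul_eq_zero, or_iff_not_imp_right]
      intro h1
      have h2 : ∀ q, (∀ b k, e b k ≠ q) → w q = u q := by
        by_contra h2
        exact h1 (if_neg h2)
      obtain ⟨q, hq⟩ := Function.ne_iff.1 hw
      obtain ⟨b, k, rfl⟩ : ∃ b k, e b k = q := by
        by_contra h3
        push Not at h3
        exact hq (h2 q h3)
      refine Finset.prod_eq_zero (Finset.mem_univ b) ?_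
      rw [Pi.single_eq_of_ne, mul_zero]
      exact fun h => hq (congrFun h k)
  rw [hN]
  funext w
  rw [Matrix.mulVec_diagonal]

end ActsOnBlocks

end Blocks

/-- Only basis states in the support of `ψ` matter, which suits a phase that is correct only when
the ancillas are clean. -/
theorem mulVec_of_eigenvectors {Q : Type} [Fintype Q] [DecidableEq Q]
    {M : Matrix (Q → Bool) (Q → Bool) ℂ} {ψ s : (Q → Bool) → ℂ}
    (h : ∀ w, ψ w ≠ 0 → M *ᵥ Pi.single w 1 = s w • Pi.single w 1) :
    M *ᵥ ψ = fun w => s w * ψ w := by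
  have h1 : ψ = ∑ w, ψ w • Pi.single w 1 := by
    funext v; simp [Finset.sum_apply, Pi.single_apply]
  funext v
  conv_lhs => rw [h1, Matrix.mulVec_sum]
  rw [Finset.sum_apply]
  have h2 : ∀ w, (M *ᵥ (ψ w • Pi.single w 1)) v = ψ w * (s w * (Pi.single w 1 : (Q → Bool) → ℂ) v) := by
    intro w
    by_cases hw : ψ w = 0
    · simp [hw]
    · simp [Matrix.mulVec_smul, h w hw]
  simp only [h2]
  simp [Pi.single_apply, mul_comm]

/-! ### Single-qubit states, the sign gate, reflections about basis states. -/

section Qubit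

/-- The single-qubit state `a|0⟩ + b|1⟩`. -/
def qubitState (a b : ℝ) : Bool → ℂ := fun x => if x then (b : ℂ) else (a : ℂ)

theorem star_qubitState_dotProduct (a b a' b' : ℝ) :
    star (qubitState a b) ⬝ᵥ qubitState a' b' = ((a * a' + b * b' : ℝ) : ℂ) := by
  simp [dotProduct, qubitState, add_comm]

theorem star_single_dotProduct_self {α : Type} [Fintype α] [DecidableEq α] (x : α) :
    star (Pi.single x 1 : α → ℂ) ⬝ᵥ Pi.single x 1 = 1 := by
  simp

variable {Q : Type} [Fintype Q] [DecidableEq Q]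

theorem star_prodState_dotProduct_self {χ : Q → Bool → ℂ} (hχ : ∀ q, star (χ q) ⬝ᵥ χ q = 1) :
    star (prodState χ) ⬝ᵥ prodState χ = 1 := by
  rw [star_prodState_dotProduct]
  exact Finset.prod_eq_one fun q _ => hχ q

theorem exists_realizable_sign (q : Q) :
    ∃ N : Matrix (Q → Bool) (Q → Bool) ℂ, Realizable 1 N ∧
      ∀ ψ, N *ᵥ ψ = fun w => (if w q then -1 else 1) * ψ w := by
  let Z : Matrix Bool Bool ℂ := Matrix.diagonal fun b => if b then -1 else 1
  have hZ : Z ∈ Matrix.unitaryGroup Bool ℂ := by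
    rw [Matrix.mem_unitaryGroup_iff, Matrix.star_eq_conjTranspose, Matrix.diagonal_conjTranspose,
      Matrix.diagonal_mul_diagonal, ← Matrix.diagonal_one]
    congr 1
    funext b
    cases b <;> simp
  refine ⟨_, Realizable.gate (QACGate.single q ⟨Z, hZ⟩), fun ψ => ?_⟩
  rw [QACGate.single_mulVec]
  funext w
  simp only [Fintype.sum_bool, Z]
  cases h : w q <;> simp <;> rw [← h, Function.update_eq_self]

theorem realizable_reflection_single [Nontrivial Q] (u : Q → Bool) :
    Realizable 3 (reflection (Pi.single u 1)) := by
  rw [single_eq_prodState]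
  exact realizable_reflection_prodState fun q => star_single_dotProduct_self _

end Qubit

/-! ### Preparation of one row by exact amplitude amplification. -/

section Rows

theorem exists_pow_eq_two {M : ℕ} (hM : 1 ≤ M) : ∃ D : ℝ, 1 < D ∧ D ^ M = 2 ∧ D ≤ 1 + 1 / M := by
  have hM' : (M : ℝ) ≠ 0 := by positivity
  have h2 : ((2 : ℝ) ^ (1 / M : ℝ)) ^ M = 2 := by
    rw [← Real.rpow_natCast, ← Real.rpow_mul (by norm_num), one_div, inv_mul_cancel₀ hM',
      Real.rpow_one]
  refine ⟨(2 : ℝ) ^ (1 / M : ℝ), ?_, h2, ?_⟩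
  · exact Real.one_lt_rpow (by norm_num) (by positivity)
  · have h := one_add_mul_le_pow (a := (1 / M : ℝ)) (by
      have : (0 : ℝ) ≤ 1 / M := by positivity
      linarith) M
    rw [mul_one_div_cancel hM'] at h
    exact le_of_pow_le_pow_left₀ (n := M) (by omega) (by positivity) (by rw [h2]; linarith)

/-- With `z = s²/c²`, the last condition says `z ^ r = D - 1` for `D ^ M = 2`, and the third fixes
`τ² = 1/(4G)` with `G = c^(2r) + s^(2r)`. That `τ² ≤ 1` uses `M ≥ r ^ r`: it gives `z ≤ 1/r`, so `(1
+ z) ^ r ≤ e < 4` and `4G ≥ 1`. -/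
theorem exists_row_parameters {r M : ℕ} (hr : 1 ≤ r) (hM : r ^ r ≤ M) :
    ∃ c s τ : ℝ, c ^ 2 + s ^ 2 = 1 ∧ τ ^ 2 ≤ 1 ∧ (τ * c ^ r) ^ 2 + (τ * s ^ r) ^ 2 = 1 / 4 ∧
      ((-2 * (τ * c ^ r)) ^ M) ^ 2 = 1 / 2 := by
  have hM1 : 1 ≤ M := (Nat.one_le_pow _ _ hr).trans hM
  have hr0 : (0 : ℝ) < r := by exact_mod_cast hr
  obtain ⟨D, hD1, hDM, hD⟩ := exists_pow_eq_two hM1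
  set z : ℝ := (D - 1) ^ (1 / r : ℝ) with hz
  have hz0 : 0 < z := Real.rpow_pos_of_pos (by linarith) _
  have hzr : z ^ r = D - 1 := by
    rw [hz, ← Real.rpow_natCast, ← Real.rpow_mul (by linarith), one_div,
      inv_mul_cancel₀ hr0.ne', Real.rpow_one]
  have hz1 : z ≤ 1 / r := by
    refine le_of_pow_le_pow_left₀ (n := r) (by omega) (by positivity) ?_
    rw [hzr, _root_.one_div_pow]
    refine (sub_le_iff_le_add'.2 hD).trans (one_div_le_one_div_of_le (by positivity) ?_)
    exact_mod_cast hM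
  have h4 : (1 + z) ^ r ≤ 4 := by
    have h1 : (1 + z) ^ r ≤ Real.exp (z * r) := by
      rw [mul_comm, Real.exp_nat_mul]
      exact pow_le_pow_left₀ (by positivity) (by linarith [Real.add_one_le_exp z]) r
    have h2 : Real.exp (z * r) ≤ Real.exp 1 :=
      Real.exp_le_exp.2 (by rwa [le_div_iff₀ hr0] at hz1)
    linarith [Real.exp_one_lt_d9]
  set G : ℝ := (1 + z ^ r) / (1 + z) ^ r with hG
  have hG0 : 0 < G := by positivity
  have hG1 : 1 ≤ 4 * G := by
    rw [hG, mul_div_assoc', le_div_iff₀ (by positivity)]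
    have : 0 < z ^ r := by positivity
    linarith
  have hc : (√(1 / (1 + z))) ^ 2 = 1 / (1 + z) := Real.sq_sqrt (by positivity)
  have hs : (√(z / (1 + z))) ^ 2 = z / (1 + z) := Real.sq_sqrt (by positivity)
  have hτ : (√(1 / (4 * G))) ^ 2 = 1 / (4 * G) := Real.sq_sqrt (by positivity)
  have hcr : ((√(1 / (1 + z))) ^ r) ^ 2 = 1 / (1 + z) ^ r := by
    rw [← pow_mul, mul_comm, pow_mul, hc, _root_.one_div_pow]
  have hsr : ((√(z / (1 + z))) ^ r) ^ 2 = z ^ r / (1 + z) ^ r := by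
    rw [← pow_mul, mul_comm, pow_mul, hs, div_pow]
  refine ⟨√(1 / (1 + z)), √(z / (1 + z)), √(1 / (4 * G)), ?_, ?_, ?_, ?_⟩
  · rw [hc, hs]; field_simp
  · rw [hτ]; exact div_le_one_of_le₀ hG1 (by positivity)
  · rw [mul_pow, mul_pow, hτ, hcr, hsr, ← mul_add, ← add_div, ← hG]
    field_simp
  · rw [pow_right_comm]
    have : (-2 * (√(1 / (4 * G)) * √(1 / (1 + z)) ^ r)) ^ 2 = 1 / D := by
      rw [mul_pow, mul_pow, hτ, hcr, hG, hzr, add_sub_cancel]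
      have : D ≠ 0 := by positivity
      field_simp
      norm_num
    rw [this, _root_.one_div_pow, hDM]

/-- The state `α|0^r⟩ + β|1^r⟩` of the qubits `some j`, next to a qubit `none` in state `|1⟩`. -/
def rowState (r : ℕ) (α β : ℝ) : (Option (Fin r) → Bool) → ℂ :=
  (α : ℂ) • Pi.single (fun q => q.isNone) 1 + (β : ℂ) • Pi.single (fun _ => true) 1

/-- A product state `χ` has weight exactly `1/4` on the span of `w₀` and `w₁`, the qubit `none`
supplying the tunable factor `τ`. Flipping the signs of these two components leaves overlap `1 - 2 ·
1/4 = 1/2` with `χ`, so reflecting about `χ` subtracts exactly `χ`. Only the two wanted components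
remain, multiplied by `-2`. -/
theorem exists_realizable_rowState {r M : ℕ} (hr : 1 ≤ r) (hM : r ^ r ≤ M) :
    ∃ α β : ℝ, (α ^ M) ^ 2 = 1 / 2 ∧
      ∃ U : Matrix (Option (Fin r) → Bool) (Option (Fin r) → Bool) ℂ, Realizable 10 U ∧
        U *ᵥ Pi.single (fun _ => false) 1 = rowState r α β := by
  have : Nonempty (Fin r) := ⟨⟨0, hr⟩⟩
  obtain ⟨c, s, τ, hcs, hτ, hq, hα⟩ := exists_row_parameters hr hM
  refine ⟨-2 * (τ * c ^ r), -2 * (τ * s ^ r), hα, ?_⟩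
  let χ : Option (Fin r) → Bool → ℂ := fun q =>
    q.elim (qubitState (√(1 - τ ^ 2)) τ) fun _ => qubitState c s
  have hχ : ∀ q, star (χ q) ⬝ᵥ χ q = 1 := by
    rintro (_ | j)
    · simp only [χ, Option.elim, star_qubitState_dotProduct]
      rw [Real.mul_self_sqrt (by linarith)]
      norm_num [sq]
    · simp only [χ, Option.elim, star_qubitState_dotProduct]
      rw [← sq, ← sq, hcs, Complex.ofReal_one]
  set w₀ : Option (Fin r) → Bool := fun q => q.isNone with hw₀
  set w₁ : Option (Fin r) → Bool := fun _ => true with hw₁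
  have hne : w₀ ≠ w₁ := fun h => by
    simpa [hw₀, hw₁] using congrFun h (some (Classical.arbitrary (Fin r)))
  obtain ⟨N, hN, hNχ⟩ := exists_realizable_prodState
    (fun q => star_single_dotProduct_self ((fun _ => false : Option (Fin r) → Bool) q)) hχ
  have h0 : prodState χ w₀ = ((τ * c ^ r : ℝ) : ℂ) := by
    simp [prodState, Fintype.prod_option, χ, hw₀, qubitState]
  have h1 : prodState χ w₁ = ((τ * s ^ r : ℝ) : ℂ) := by
    simp [prodState, Fintype.prod_option, χ, hw₁, qubitState]
  refine ⟨reflection (prodState χ) * (reflection (Pi.single w₁ 1) *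
    (reflection (Pi.single w₀ 1) * N)), ?_, ?_⟩
  · exact (realizable_reflection_prodState hχ).mul ((realizable_reflection_single w₁).mul
      ((realizable_reflection_single w₀).mul hN))
  · rw [← Matrix.mulVec_mulVec, ← Matrix.mulVec_mulVec, ← Matrix.mulVec_mulVec,
      single_eq_prodState (fun _ => false), hNχ, reflection_mulVec, reflection_mulVec, reflection_mulVec]
    have e0 : star (Pi.single w₀ 1 : _ → ℂ) ⬝ᵥ prodState χ = prodState χ w₀ := by
      simp
    have e1 : star (Pi.single w₁ 1 : _ → ℂ) ⬝ᵥ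
        (prodState χ - (2 * prodState χ w₀) • Pi.single w₀ 1) = prodState χ w₁ := by
      simp [hne]
    have eχ : star (prodState χ) ⬝ᵥ (prodState χ - (2 * prodState χ w₀) • Pi.single w₀ 1 -
        (2 * prodState χ w₁) • Pi.single w₁ 1) = 1 / 2 := by
      rw [dotProduct_sub, dotProduct_sub, star_prodState_dotProduct_self hχ,
        dotProduct_smul, dotProduct_smul, dotProduct_single, dotProduct_single, Pi.star_apply,
        Pi.star_apply, h0, h1]
      have : (((τ * c ^ r) ^ 2 + (τ * s ^ r) ^ 2 : ℝ) : ℂ) = ((1 / 4 : ℝ) : ℂ) := by rw [hq]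
      simp only [Complex.ofReal_add, Complex.ofReal_pow, Complex.ofReal_div, Complex.ofReal_one,
        Complex.ofReal_ofNat] at this
      simp only [smul_eq_mul, mul_one, RCLike.star_def, Complex.conj_ofReal]
      linear_combination (-2) * this
    rw [e0, e1, eχ, h0, h1, rowState]
    funext w
    simp only [Pi.sub_apply, Pi.add_apply, Pi.smul_apply, smul_eq_mul, Complex.ofReal_mul,
      Complex.ofReal_neg, Complex.ofReal_ofNat, Complex.ofReal_pow]
    ring

end Rows

/-! ### Exact fan-out of a bit through a phase. -/

section FanOut

/-- The parity sign `(-1)^b`. -/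
def bitSign (b : Bool) : ℂ := if b then -1 else 1

theorem prod_bitSign_eq {ι : Type} [Fintype ι] (y : ι → Bool) :
    (∏ j, bitSign (y j)) = 1 ∨ (∏ j, bitSign (y j)) = -1 := by
  refine Finset.prod_induction (fun j => bitSign (y j)) (fun z => z = 1 ∨ z = -1) ?_ (Or.inl rfl)
    fun j _ => ?_
  · rintro a b (rfl | rfl) (rfl | rfl) <;> simp
  · cases y j <;> simp [bitSign]

variable {r M : ℕ}

/-- The state of `M` rows in the state `rowState r α β`. -/
def rowsState (r M : ℕ) (α β : ℝ) : (Fin M × Option (Fin r) → Bool) → ℂ :=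
  fun v => ∏ m, rowState r α β fun k => v (m, k)

/-- The rows with the sign `σ` in front of the part in which some row is nonzero. -/
def signedRowsState (r M : ℕ) (α β : ℝ) (σ : ℂ) : (Fin M × Option (Fin r) → Bool) → ℂ :=
  fun v => (if ∃ m j, v (m, some j) = true then σ else 1) * rowsState r M α β v

theorem signedRowsState_one (α β : ℝ) : signedRowsState r M α β 1 = rowsState r M α β := by
  funext v
  simp [signedRowsState]

theorem rowState_ne_zero {α β : ℝ} {w : Option (Fin r) → Bool} (h : rowState r α β w ≠ 0) :
    w none = true ∧ ((∀ j, w (some j) = false) ∨ ∀ j, w (some j) = true) := by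
  rw [rowState, Pi.add_apply, Pi.smul_apply, Pi.smul_apply, Pi.single_apply, Pi.single_apply] at h
  by_cases h0 : w = fun q => q.isNone
  · subst h0; simp
  · by_cases h1 : w = fun _ => true
    · subst h1; simp
    · simp [h0, h1] at h

/-- The basis state in which all the rows are zero. -/
def zeroRows (r M : ℕ) : Fin M × Option (Fin r) → Bool := fun p => p.2.isNone

/-- In the support of the rows' state the qubits `none` are all `1`, so `zeroRows` is the only basis
state there without a nonzero row, hence the only one that keeps its sign. -/
theorem signedRowsState_neg_one (α β : ℝ) : signedRowsState r M α β (-1) =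
    (2 * rowsState r M α β (zeroRows r M)) • Pi.single (zeroRows r M) 1 - rowsState r M α β := by
  funext v
  rw [signedRowsState, Pi.sub_apply, Pi.smul_apply, Pi.single_apply, smul_eq_mul]
  by_cases hv : v = zeroRows r M
  · subst hv
    rw [if_neg (by simp [zeroRows])]
    simp only [if_true]
    ring
  · rw [if_neg hv]
    by_cases h0 : rowsState r M α β v = 0
    · simp [h0]
    · rw [if_pos]
      · ring
      · by_contra hne
        push Not at hne
        apply hv
        funext ⟨m, k⟩
        cases k with
        | some j => simpa [zeroRows] using hne m j
        | none =>
          exact (rowState_ne_zero (Finset.prod_ne_zero_iff.1 h0 m (Finset.mem_univ m))).1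

theorem rowsState_zeroRows (hr : 1 ≤ r) (α β : ℝ) :
    rowsState r M α β (zeroRows r M) = ((α ^ M : ℝ) : ℂ) := by
  have h : ∀ m, rowState r α β (fun k => zeroRows r M (m, k)) = α := by
    intro m
    have h1 : (fun k => zeroRows r M (m, k)) ≠ fun _ => true := fun h => by
      simpa [zeroRows] using congrFun h (some ⟨0, hr⟩)
    rw [rowState, Pi.add_apply, Pi.smul_apply, Pi.smul_apply, Pi.single_eq_of_ne h1]
    simp [zeroRows]
  simp [rowsState, h]

/-- Every row in the support is constant, so a nonzero row shows up in each column: the ORs of the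
columns are copies of one bit. -/
theorem rowsState_ne_zero {α β : ℝ} {v : Fin M × Option (Fin r) → Bool}
    (h : rowsState r M α β v ≠ 0) (j : Fin r) :
    (∃ m, v (m, some j) = true) ↔ ∃ m j', v (m, some j') = true := by
  refine ⟨fun ⟨m, hm⟩ => ⟨m, j, hm⟩, fun ⟨m, j', hm⟩ => ⟨m, ?_⟩⟩
  rcases (rowState_ne_zero (Finset.prod_ne_zero_iff.1 h m (Finset.mem_univ m))).2 with h0 | h1
  · exact absurd (h0 j') (by simp [hm])
  · exact h1 j

/-- The register of the fan-out of one qubit `none` into `r` qubits, with ancillas. -/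
abbrev FanOutRegister (r M : ℕ) : Type := Option (Fin r ⊕ Fin M × Option (Fin r))

/-- The register with the input in state `x`, the copies in state `y` and the rows in state `φ`. -/
def fanOutState (x : Bool) (y : Fin r → Bool) (φ : (Fin M × Option (Fin r) → Bool) → ℂ) :
    (FanOutRegister r M → Bool) → ℂ :=
  fun w => φ (fun p => w (some (Sum.inr p))) *
    if w none = x ∧ ∀ j, w (some (Sum.inl j)) = y j then 1 else 0

theorem single_eq_fanOutState (w : FanOutRegister r M → Bool) :
    (Pi.single w 1 : _ → ℂ) = fanOutState (w none) (fun j => w (some (Sum.inl j)))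
      (Pi.single (fun p => w (some (Sum.inr p))) 1) := by
  funext v
  simp only [fanOutState, Pi.single_apply, mul_ite, mul_one, mul_zero, ← ite_and]
  congr 1
  rw [eq_iff_iff]
  constructor
  · rintro rfl; simp
  · rintro ⟨⟨h1, h2⟩, h3⟩
    funext q
    rcases q with _ | j | p
    exacts [h1, h2 j, congrFun h3 p]

/-- Rows side by side in a larger register. -/
theorem exists_realizable_rows {Q : Type} [Fintype Q] [DecidableEq Q]
    (e : Fin M × Option (Fin r) → Q) (he : Function.Injective e) {α β : ℝ} {d : ℕ}
    {U : Matrix (Option (Fin r) → Bool) (Option (Fin r) → Bool) ℂ} (hU : Realizable d U)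
    (hU0 : U *ᵥ Pi.single (fun _ => false) 1 = rowState r α β) :
    ∃ N : Matrix (Q → Bool) (Q → Bool) ℂ, Realizable d N ∧ ∀ g : (Q → Bool) → ℂ,
      (∀ w p c, g (Function.update w (e p) c) = g w) →
      N *ᵥ (fun w => (Pi.single (fun _ => false) 1 : _ → ℂ) (w ∘ e) * g w) =
        fun w => rowsState r M α β (w ∘ e) * g w := by
  obtain ⟨N, hN, h⟩ := ActsOnBlocks.exists_realizable (β := Fin M)
    (K := fun _ => Option (Fin r)) (fun m k => e (m, k))
    (fun p p' hp => by
      obtain ⟨m, k⟩ := p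
      obtain ⟨m', k'⟩ := p'
      have := he hp
      simp only [Prod.mk.injEq] at this
      obtain ⟨rfl, rfl⟩ := this
      rfl) (M := fun _ => U) fun _ => hU
  refine ⟨N, hN, fun g hg => ?_⟩
  have := h (fun _ => Pi.single (fun _ => false) 1) g fun w m k c => hg w (m, k) c
  simp only [hU0] at this
  refine Eq.trans ?_ this
  congr 1
  funext w
  congr 1
  simp only [Pi.single_apply, Finset.prod_ite_zero, Finset.prod_const_one, Finset.mem_univ,
    true_imp_iff, funext_iff, Prod.forall, Function.comp_apply]

/-- The sign `(-1)^(y ∧ (v₁ ∨ ⋯ ∨ v_M))`. -/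
theorem exists_realizable_orSign (M : ℕ) (hM : 1 ≤ M) :
    ∃ D : Matrix (Option (Fin M) → Bool) (Option (Fin M) → Bool) ℂ, Realizable 4 D ∧
      ∀ v, D *ᵥ Pi.single v 1 =
        (if (∃ m, v (some m) = true) then bitSign (v none) else 1) • Pi.single v 1 := by
  have : Nonempty (Fin M) := ⟨⟨0, hM⟩⟩
  obtain ⟨Z, hZ, hZψ⟩ := exists_realizable_sign (none : Option (Fin M))
  -- The sign gate contributes `(-1)^y`; the reflection cancels it exactly at `y = 1`, `v = 0`.
  refine ⟨reflection (Pi.single (fun q => q.isNone) 1) * Z,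
    (realizable_reflection_single _).mul hZ, fun v => ?_⟩
  have hZv : Z *ᵥ Pi.single v 1 = bitSign (v none) • Pi.single v 1 := by
    rw [hZψ]
    funext w
    by_cases hw : w = v
    · subst hw; simp [bitSign]
    · simp [hw]
  rw [← Matrix.mulVec_mulVec, hZv, reflection_mulVec]
  by_cases hv : v = fun q => q.isNone
  · subst hv
    simp only [dotProduct_smul, star_single_dotProduct_self, smul_eq_mul]
    rw [if_neg (by simp), show bitSign ((fun q : Option (Fin M) => q.isNone) none) = -1 from rfl,
      ← sub_smul]
    norm_num
  · have h0 : star (Pi.single (fun q => q.isNone) 1 : (Option (Fin M) → Bool) → ℂ) ⬝ᵥ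
        (bitSign (v none) • Pi.single v 1 : (Option (Fin M) → Bool) → ℂ) = 0 := by
      simp [hv]
    rw [h0, mul_zero, zero_smul, sub_zero]
    split_ifs with hex
    · rfl
    · cases hn : v none
      · rfl
      · refine absurd (funext fun q => ?_) hv
        push Not at hex
        cases q with
        | none => simpa using hn
        | some m => simpa using hex m

theorem star_dotProduct_optionState {P : Type} [Fintype P] [DecidableEq P]
    (φ ψ : (P → Bool) → ℂ) (x : Bool) :
    star (fun v : Option P → Bool => φ (v ∘ some) * if v none = true then 1 else 0) ⬝ᵥ
      (fun v => ψ (v ∘ some) * if v none = x then 1 else 0) =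
      if x then star φ ⬝ᵥ ψ else 0 := by
  have h := Fintype.sum_equiv (Equiv.piOptionEquivProd (β := fun _ : Option P => Bool))
    (fun v : Option P → Bool => star (φ (v ∘ some) * if v none = true then 1 else 0) *
      (ψ (v ∘ some) * if v none = x then 1 else 0))
    (fun p => star (φ p.2 * if p.1 = true then 1 else 0) * (ψ p.2 * if p.1 = x then 1 else 0))
    (fun v => rfl)
  simp only [dotProduct, Pi.star_apply]
  rw [h, Fintype.sum_prod_type, Fintype.sum_bool]
  cases x <;> simp

/-- As `α ^ M` has square `1/2`, the rows' states with signs `1` and `-1` are orthogonal. The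
reflection about `|1⟩` times the unsigned state therefore tells them apart, and the sign gate on
`none` turns its outcome into `σ` when `x` is true. Both states are left intact. -/
theorem exists_realizable_controlled_sign (hr : 1 ≤ r) (hM : 1 ≤ M) {α β : ℝ} {d : ℕ}
    {U : Matrix (Option (Fin r) → Bool) (Option (Fin r) → Bool) ℂ} (hU : Realizable d U)
    (hU0 : U *ᵥ Pi.single (fun _ => false) 1 = rowState r α β) (hα : (α ^ M) ^ 2 = 1 / 2) :
    ∃ D : Matrix (Option (Fin M × Option (Fin r)) → Bool)
        (Option (Fin M × Option (Fin r)) → Bool) ℂ, Realizable (d + 3 + d + 1) D ∧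
      ∀ (x : Bool) (σ : ℂ), σ = 1 ∨ σ = -1 →
        D *ᵥ (fun v => signedRowsState r M α β σ (v ∘ some) * if v none = x then 1 else 0) =
          (if x then σ else 1) •
            fun v => signedRowsState r M α β σ (v ∘ some) * if v none = x then 1 else 0 := by
  have : Nonempty (Fin M) := ⟨⟨0, hM⟩⟩
  obtain ⟨Z, hZ, hZψ⟩ := exists_realizable_sign (none : Option (Fin M × Option (Fin r)))
  obtain ⟨N, hN, hN'⟩ := exists_realizable_rows (M := M)
    (some : _ → Option (Fin M × Option (Fin r))) (Option.some_injective _) hU hU0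
  have hN1 := hN' (fun v => if v none = true then 1 else 0) fun w p c => by simp
  have hsingle : (fun v : Option (Fin M × Option (Fin r)) → Bool =>
      (Pi.single (fun _ => false) 1 : _ → ℂ) (v ∘ some) * if v none = true then 1 else 0) =
      Pi.single (fun q => q.isNone) 1 := by
    funext v
    simp only [Pi.single_apply, mul_ite, mul_one, mul_zero, ← ite_and]
    congr 1
    rw [eq_iff_iff, funext_iff, funext_iff, Option.forall]
    simp
  rw [hsingle] at hN1
  have hnorm : star (rowsState r M α β) ⬝ᵥ rowsState r M α β = 1 := by
    have h1 := hN.dotProduct_mulVec (Pi.single (fun q => q.isNone) 1)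
      (Pi.single (fun q => q.isNone) 1)
    rw [hN1, star_single_dotProduct_self, star_dotProduct_optionState] at h1
    simpa using h1
  have hinner : star (rowsState r M α β) ⬝ᵥ signedRowsState r M α β (-1) = 0 := by
    rw [signedRowsState_neg_one, dotProduct_sub, dotProduct_smul, hnorm, dotProduct_single,
      Pi.star_apply, rowsState_zeroRows hr, RCLike.star_def, Complex.conj_ofReal, mul_one,
      smul_eq_mul, mul_assoc, ← Complex.ofReal_mul, ← sq, hα]
    norm_num
  refine ⟨_, (hN.reflection_mulVec (realizable_reflection_single _) hN1).mul hZ, fun x σ hσ => ?_⟩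
  rw [← Matrix.mulVec_mulVec, hZψ]
  have hZx : (fun w : Option (Fin M × Option (Fin r)) → Bool => (if w none = true then -1 else 1) *
      (signedRowsState r M α β σ (w ∘ some) * if w none = x then 1 else 0)) =
      (if x then (-1 : ℂ) else 1) •
        fun v => signedRowsState r M α β σ (v ∘ some) * if v none = x then 1 else 0 := by
    funext w
    simp only [Pi.smul_apply, smul_eq_mul]
    by_cases hw : w none = x
    · simp [hw]
    · simp [hw]
  rw [hZx, Matrix.mulVec_smul, reflection_mulVec, star_dotProduct_optionState]
  cases x
  · simp
  · simp only [if_true]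
    rcases hσ with rfl | rfl
    · rw [signedRowsState_one, hnorm, mul_one, two_smul]
      simp
    · rw [hinner]
      simp

theorem exists_hadamard : ∃ (H : Matrix.unitaryGroup Bool ℂ) (κ : ℂ),
    (H : Matrix Bool Bool ℂ) *ᵥ Pi.single false 1 = (fun _ => κ) ∧
      (H : Matrix Bool Bool ℂ) *ᵥ Pi.single true 1 = fun b => bitSign b * κ := by
  have hsq : ((√(1 / 2) : ℝ) : ℂ) * ((√(1 / 2) : ℝ) : ℂ) = 1 / 2 := by
    rw [← Complex.ofReal_mul, Real.mul_self_sqrt (by norm_num)]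
    norm_num
  generalize √(1 / 2) = κ at hsq
  refine ⟨⟨Matrix.of fun i j => if j then bitSign i * κ else (κ : ℂ), ?_⟩, κ, ?_, ?_⟩
  · rw [Matrix.mem_unitaryGroup_iff]
    ext i j
    cases i <;> cases j <;> simp [Matrix.mul_apply, Matrix.star_apply, bitSign] <;>
      linear_combination 2 * hsq
  · funext i
    simp
  · funext i
    simp

/-- The exact fan-out of a bit into `r` copies. -/
theorem exists_realizable_fanOut {r M : ℕ} (hr : 1 ≤ r) (hM : r ^ r ≤ M) :
    ∃ N : Matrix (FanOutRegister r M → Bool) (FanOutRegister r M → Bool) ℂ, Realizable 60 N ∧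
      ∀ x : Bool, N *ᵥ Pi.single (fun q => q.elim x fun _ => false) 1 =
        Pi.single (fun q => q.elim x (Sum.elim (fun _ => x) fun _ => false)) 1 := by
  have hM1 : 1 ≤ M := (Nat.one_le_pow _ _ hr).trans hM
  obtain ⟨α, β, hα, U, hU, hU0⟩ := exists_realizable_rowState hr hM
  obtain ⟨A, hA, hA'⟩ := exists_realizable_rows (M := M)
    (fun p => (some (Sum.inr p) : FanOutRegister r M)) (fun p p' h => by simpa using h) hU hU0
  obtain ⟨D, hD, hD'⟩ := exists_realizable_orSign M hM1
  obtain ⟨B, hB, hB'⟩ := ActsOnBlocks.exists_realizable (β := Fin r) (K := fun _ => Option (Fin M))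
    (fun j k => (k.elim (some (Sum.inl j)) fun m => some (Sum.inr (m, some j)) :
      FanOutRegister r M)) (by
      rintro ⟨j, _ | m⟩ ⟨j', _ | m'⟩ h <;> simp_all) (M := fun _ => D) fun _ => hD
  obtain ⟨E, hE, hE'⟩ := exists_realizable_controlled_sign hr hM1 hU hU0 hα
  obtain ⟨C, hC, hC'⟩ := ActsOnBlocks.exists_realizable (β := Unit)
    (K := fun _ => Option (Fin M × Option (Fin r)))
    (fun _ k => (k.map Sum.inr : FanOutRegister r M)) (by
      rintro ⟨_, _ | m⟩ ⟨_, _ | m'⟩ h <;> simp_all) (M := fun _ => E) fun _ => hE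
  have hA1 : ∀ x y, A *ᵥ fanOutState x y (Pi.single (fun _ => false) 1) =
      fanOutState x y (rowsState r M α β) := fun x y =>
    hA' (fun w => if w none = x ∧ ∀ j, w (some (Sum.inl j)) = y j then 1 else 0)
      fun w p c => by simp
  have hB1 : ∀ ψ, B *ᵥ ψ = fun w => (∏ j, if (∃ m, w (some (Sum.inr (m, some j))) = true) then
      bitSign (w (some (Sum.inl j))) else 1) * ψ w := fun ψ =>
    hB'.mulVec_of_diagonal (fun _ v => hD' v) ψ
  have hB2 : ∀ ψ, B *ᵥ (B *ᵥ ψ) = ψ := by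
    intro ψ
    rw [hB1, hB1]
    funext w
    rw [← mul_assoc, ← Finset.prod_mul_distrib, Finset.prod_eq_one, one_mul]
    intro j _
    split_ifs
    · cases w (some (Sum.inl j)) <;> simp [bitSign]
    · simp
  have hB3 : ∀ x y, B *ᵥ fanOutState x y (rowsState r M α β) =
      fanOutState x y (signedRowsState r M α β (∏ j, bitSign (y j))) := by
    intro x y
    rw [hB1]
    funext w
    simp only [fanOutState, signedRowsState]
    by_cases hw : w none = x ∧ ∀ j, w (some (Sum.inl j)) = y j
    · by_cases h0 : rowsState r M α β (fun p => w (some (Sum.inr p))) = 0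
      · simp [h0]
      · simp only [hw.2, rowsState_ne_zero h0]
        split_ifs <;> simp
    · simp [hw]
  have hC1 : ∀ (x : Bool) (y : Fin r → Bool) (σ : ℂ), σ = 1 ∨ σ = -1 →
      C *ᵥ fanOutState x y (signedRowsState r M α β σ) =
        (if x then σ else 1) • fanOutState x y (signedRowsState r M α β σ) := by
    intro x y σ hσ
    have h1 := hC' (fun _ v => signedRowsState r M α β σ (v ∘ some) *
      if v none = x then 1 else 0) (fun w => if ∀ j, w (some (Sum.inl j)) = y j then 1 else 0)
      fun w _ k c => by cases k <;> simp
    have h2 : fanOutState x y (signedRowsState r M α β σ) = fun w : FanOutRegister r M → Bool =>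
        (∏ _u : Unit, signedRowsState r M α β σ ((w ∘ fun k => k.map Sum.inr) ∘ some) *
          if (w ∘ fun k : Option (Fin M × Option (Fin r)) => k.map Sum.inr) none = x
            then 1 else 0) * if ∀ j, w (some (Sum.inl j)) = y j then 1 else 0 := by
      funext w
      simp only [fanOutState, ite_and, Finset.univ_unique, Finset.prod_singleton, mul_assoc,
        Function.comp_apply, Option.map_none, ite_mul, one_mul, zero_mul]
      rfl
    rw [h2, h1]
    simp only [hE' x σ hσ]
    funext w
    simp
  -- `A` prepares the rows, `B` imprints the parity of `y` as a sign on their nonzero part, and `C`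
  -- reads that sign under the control of `x`. Undoing `B` and `A` leaves the phase `(-1)^(x ·
  -- parity y)` and clean ancillas.
  have hphase : ∀ w : FanOutRegister r M → Bool, (∀ p, w (some (Sum.inr p)) = false) →
      (Aᴴ * (B * (C * (B * A)))) *ᵥ Pi.single w 1 =
        (if w none then ∏ j, bitSign (w (some (Sum.inl j))) else 1) • Pi.single w 1 := by
    intro w hw
    have hw' : (fun p => w (some (Sum.inr p))) = fun _ => false := funext hw
    simp only [← Matrix.mulVec_mulVec]
    rw [single_eq_fanOutState, hw', hA1, hB3, hC1 _ _ _ (prod_bitSign_eq _), Matrix.mulVec_smul,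
      ← hB3, hB2, Matrix.mulVec_smul, hA.conjTranspose_mulVec (hA1 _ _)]
  have hP : Realizable 58 (Aᴴ * (B * (C * (B * A)))) :=
    (hA.conjTranspose.mul (hB.mul (hC.mul (hB.mul hA)))).mono (by norm_num)
  obtain ⟨H, κ, hH0, hH1⟩ := exists_hadamard
  obtain ⟨L, hL, hL'⟩ := exists_realizable_unitaries
    fun q : FanOutRegister r M => q.elim 1 (Sum.elim (fun _ => H) fun _ => 1)
  have hf : ∀ x, L *ᵥ Pi.single (fun q => q.elim x fun _ => false) 1 = prodState
      fun q => q.elim (Pi.single x 1) (Sum.elim (fun _ _ => κ) fun _ => Pi.single false 1) := by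
    intro x
    rw [single_eq_prodState, hL']
    congr 1
    funext q
    rcases q with _ | j | p
    exacts [Matrix.one_mulVec _, hH0, Matrix.one_mulVec _]
  have hg : ∀ x, L *ᵥ Pi.single (fun q => q.elim x (Sum.elim (fun _ => x) fun _ => false)) 1 =
      prodState fun q => q.elim (Pi.single x 1)
        (Sum.elim (fun _ b => (if x then bitSign b else 1) * κ) fun _ => Pi.single false 1) := by
    intro x
    rw [single_eq_prodState, hL']
    congr 1
    funext q
    rcases q with _ | j | p
    · exact Matrix.one_mulVec _
    · cases x
      · exact hH0.trans (by simp)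
      · exact hH1.trans (by simp)
    · exact Matrix.one_mulVec _
  refine ⟨Lᴴ * ((Aᴴ * (B * (C * (B * A)))) * L),
    (hL.conjTranspose.mul (hP.mul hL)).mono (by norm_num), fun x => ?_⟩
  rw [← Matrix.mulVec_mulVec, ← Matrix.mulVec_mulVec]
  -- Hadamard gates on the copies turn `x = 1` targets into sign characters, so the phase must map
  -- the image of the input under `L` to the image of the output.
  refine hL.conjTranspose_mulVec ?_
  rw [hf, hg]
  symm
  refine (mulVec_of_eigenvectors (s := fun w => if w none then
    ∏ j, bitSign (w (some (Sum.inl j))) else 1) fun w hw => hphase w fun p => ?_).trans ?_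
  · by_contra hp
    refine hw (Finset.prod_eq_zero (Finset.mem_univ (some (Sum.inr p))) ?_)
    simp [hp]
  · funext w
    simp only [prodState, Fintype.prod_option, Fintype.prod_sum_type, Option.elim, Sum.elim_inl,
      Sum.elim_inr]
    by_cases hx : w none = x
    · cases x
      · simp [hx]
      · simp only [hx, if_true, Finset.prod_mul_distrib]
        ring
    · simp [hx]
end FanOut

/-! ### Iterated fan-out. -/

section FanOutTree

/-- A bit in the qubit `none` can be copied into the qubits `cp c`, with ancillas `V`. -/
def HasFanOut (d : ℕ) (V C : Type) [Fintype V] [DecidableEq V] : Prop :=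
  ∃ (cp : C → Option V) (N : Matrix (Option V → Bool) (Option V → Bool) ℂ),
    Function.Injective cp ∧ Realizable d N ∧ ∀ x : Bool, ∃ u : Option V → Bool,
      (∀ c, u (cp c) = x) ∧ N *ᵥ Pi.single (fun q => q.elim x fun _ => false) 1 = Pi.single u 1

/-- Every copy made by the first stage is the input of its own second-stage fan-out; these run in
parallel, so depths add while the numbers of copies multiply. -/
theorem HasFanOut.comp {d₁ d₂ : ℕ} {V₁ C₁ V₂ C₂ : Type} [Fintype V₁] [DecidableEq V₁]
    [Fintype C₁] [DecidableEq C₁] [Fintype V₂] [DecidableEq V₂] (h₁ : HasFanOut d₁ V₁ C₁)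
    (h₂ : HasFanOut d₂ V₂ C₂) : HasFanOut (d₂ + d₁) (V₁ ⊕ C₁ × V₂) (C₁ × C₂) := by
  obtain ⟨cp₁, N₁, hcp₁, hN₁, h₁⟩ := h₁
  obtain ⟨cp₂, N₂, hcp₂, hN₂, h₂⟩ := h₂
  have he₁ : Function.Injective fun p : Σ _ : Unit, Option V₁ =>
      (p.2.map Sum.inl : Option (V₁ ⊕ C₁ × V₂)) := by
    rintro ⟨_, _ | v⟩ ⟨_, _ | v'⟩ h <;> simp_all
  obtain ⟨A, hA, hA'⟩ := ActsOnBlocks.exists_realizable (β := Unit) (K := fun _ => Option V₁)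
    (fun _ k => (k.map Sum.inl : Option (V₁ ⊕ C₁ × V₂))) he₁ (M := fun _ => N₁) fun _ => hN₁
  let e : C₁ → Option V₂ → Option (V₁ ⊕ C₁ × V₂) := fun c k =>
    k.elim ((cp₁ c).map Sum.inl) fun v => some (Sum.inr (c, v))
  have he : Function.Injective fun p : Σ _ : C₁, Option V₂ => e p.1 p.2 := by
    have hno : ∀ (p : Option V₁) (q : C₁ × V₂), p.map Sum.inl ≠ some (Sum.inr q) := by
      rintro (_ | v) q <;> simp
    rintro ⟨c, _ | v⟩ ⟨c', _ | v'⟩ h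
    · have h' : cp₁ c = cp₁ c' := Option.map_injective Sum.inl_injective h
      rw [hcp₁ h']
    · exact absurd h (hno _ _)
    · exact absurd h.symm (hno _ _)
    · simp only [e, Option.elim, Option.some.injEq, Sum.inr.injEq, Prod.mk.injEq] at h
      rw [h.1, h.2]
  obtain ⟨B, hB, hB'⟩ := ActsOnBlocks.exists_realizable e he (M := fun _ => N₂) fun _ => hN₂
  refine ⟨fun c => e c.1 (cp₂ c.2), B * A, ?_, hB.mul hA, fun x => ?_⟩
  · rintro ⟨c, k⟩ ⟨c', k'⟩ h
    have := he (a₁ := ⟨c, cp₂ k⟩) (a₂ := ⟨c', cp₂ k'⟩) h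
    simp only [Sigma.mk.injEq, heq_eq_eq] at this
    rw [this.1, hcp₂ this.2]
  · obtain ⟨w₁, hw₁, hN₁x⟩ := h₁ x
    obtain ⟨w₂, hw₂, hN₂x⟩ := h₂ x
    let u₁ : Option (V₁ ⊕ C₁ × V₂) → Bool :=
      Function.extend (fun p : Σ _ : Unit, Option V₁ => p.2.map Sum.inl) (fun p => w₁ p.2)
        fun _ => false
    let u₂ : Option (V₁ ⊕ C₁ × V₂) → Bool :=
      Function.extend (fun p : Σ _ : C₁, Option V₂ => e p.1 p.2) (fun p => w₂ p.2) u₁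
    have hu₁ : ∀ k, u₁ (k.map Sum.inl) = w₁ k := fun k => he₁.extend_apply _ _ ⟨(), k⟩
    have hu₁' : ∀ p, u₁ (some (Sum.inr p)) = false := fun p =>
      Function.extend_apply' _ _ _ (by rintro ⟨⟨_, _ | v⟩, h⟩ <;> simp at h)
    have hu₂ : ∀ c k, u₂ (e c k) = w₂ k := fun c k => he.extend_apply _ _ ⟨c, k⟩
    refine ⟨u₂, fun c => by rw [hu₂, hw₂], ?_⟩
    rw [← Matrix.mulVec_mulVec, hA'.mulVec_single_eq_single (u' := u₁),
      hB'.mulVec_single_eq_single (u' := u₂)]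
    · intro c
      have h2 : u₂ ∘ e c = w₂ := funext fun k => hu₂ c k
      have h1 : u₁ ∘ e c = fun q => q.elim x fun _ => false := by
        funext k
        cases k with
        | none => exact (hu₁ _).trans (hw₁ c)
        | some v => exact hu₁' _
      rw [h1, h2, hN₂x]
    · intro q hq
      exact Function.extend_apply' _ _ _ fun ⟨p, hp⟩ => hq p.1 p.2 hp
    · intro _
      have h2 : u₁ ∘ (fun k => k.map Sum.inl) = w₁ := funext hu₁
      rw [h2, ← hN₁x]
      congr 2
      funext k
      cases k <;> rfl
    · intro q hq
      rw [show u₁ q = false from Function.extend_apply' _ _ _ fun ⟨p, hp⟩ => hq p.1 p.2 hp]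
      cases q with
      | none => exact absurd rfl (hq () none)
      | some _ => rfl

theorem HasFanOut.iterate {d : ℕ} {V C : Type} [Fintype V] [DecidableEq V] [Fintype C]
    [DecidableEq C] [Nonempty C] (h : HasFanOut d V C) (k : ℕ) :
    ∃ (V' C' : Type) (_ : Fintype V') (_ : DecidableEq V') (_ : Fintype C') (_ : DecidableEq C'),
      Fintype.card C' = Fintype.card C ^ k ∧
      Fintype.card V' ≤ k * Fintype.card C ^ k * Fintype.card V ∧ HasFanOut (d * k) V' C' := by
  induction k with
  | zero =>
    refine ⟨Empty, Unit, inferInstance, inferInstance, inferInstance, inferInstance, by simp,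
      by simp, fun _ => none, 1, fun _ _ _ => rfl, Realizable.one _, fun x => ?_⟩
    exact ⟨fun q => q.elim x fun _ => false, by simp, Matrix.one_mulVec _⟩
  | succ k ih =>
    obtain ⟨V', C', _, _, _, _, hC, hV, h'⟩ := ih
    refine ⟨V' ⊕ C' × V, C' × C, inferInstance, inferInstance, inferInstance, inferInstance,
      by rw [Fintype.card_prod, hC, pow_succ], ?_, by
        rw [Nat.mul_succ, add_comm]; exact h'.comp h⟩
    rw [Fintype.card_sum, Fintype.card_prod, hC]
    have h1 : Fintype.card C ^ k ≤ Fintype.card C ^ (k + 1) :=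
      Nat.pow_le_pow_right Fintype.card_pos (Nat.le_succ k)
    calc _ ≤ k * Fintype.card C ^ k * Fintype.card V + Fintype.card C ^ k * Fintype.card V := by
            gcongr
      _ = (k + 1) * Fintype.card C ^ k * Fintype.card V := by ring
      _ ≤ _ := by gcongr

theorem hasFanOut_base {r M : ℕ} (hr : 1 ≤ r) (hM : r ^ r ≤ M) :
    HasFanOut 60 (Fin r ⊕ Fin M × Option (Fin r)) (Fin r) := by
  obtain ⟨N, hN, h⟩ := exists_realizable_fanOut hr hM
  exact ⟨fun j => some (Sum.inl j), N, fun j j' h => by simpa using h, hN,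
    fun x => ⟨_, fun c => rfl, h x⟩⟩

end FanOutTree

/-! ### One control flipping the signs of many encoded qubits. -/

section Rotation

theorem single_false_eq_qubitState : (Pi.single false 1 : Bool → ℂ) = qubitState 1 0 := by
  funext b
  cases b <;> simp [qubitState]

theorem star_qubitState_dotProduct_self {a b : ℝ} (h : a ^ 2 + b ^ 2 = 1) :
    star (qubitState a b) ⬝ᵥ qubitState a b = 1 := by
  rw [star_qubitState_dotProduct, ← sq, ← sq, h, Complex.ofReal_one]

/-- A qubit `none` in state `|x⟩`, next to `N` qubits in the state `c|0⟩ ± s|1⟩`, with the sign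
`(-1)^x`. -/
theorem exists_realizable_controlled_rotation {N : ℕ} (hN1 : 1 ≤ N) {c s : ℝ}
    (hcs : c ^ 2 + s ^ 2 = 1) (hN : (c ^ 2 - s ^ 2) ^ N = 1 / 2) :
    ∃ B : Matrix (Option (Fin N) → Bool) (Option (Fin N) → Bool) ℂ, Realizable 8 B ∧
      ∀ x : Bool, B *ᵥ Pi.single (fun q => q.elim x fun _ => false) 1 =
        prodState fun q => q.elim (Pi.single x 1) fun _ => qubitState c (if x then -s else s) := by
  have : Nonempty (Fin N) := ⟨⟨0, hN1⟩⟩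
  let φ : Bool → Bool → Option (Fin N) → Bool → ℂ := fun x y q =>
    q.elim (Pi.single x 1) fun _ => qubitState c (if y then -s else s)
  have hφ : ∀ x y q, star (φ x y q) ⬝ᵥ φ x y q = 1 := by
    rintro x y (_ | t)
    · exact star_single_dotProduct_self x
    · cases y
      · exact star_qubitState_dotProduct_self hcs
      · exact star_qubitState_dotProduct_self (by rw [if_pos rfl]; linarith [neg_sq s])
  have hin : ∀ y y', y ≠ y' → star (prodState (φ true y)) ⬝ᵥ prodState (φ true y') = 1 / 2 := by
    intro y y' hy
    rw [star_prodState_dotProduct, Fintype.prod_option]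
    have : ∀ t : Fin N, star (φ true y (some t)) ⬝ᵥ φ true y' (some t) =
        ((c ^ 2 - s ^ 2 : ℝ) : ℂ) := by
      intro t
      simp only [φ, Option.elim, star_qubitState_dotProduct]
      congr 1
      cases y <;> cases y' <;> simp at hy ⊢ <;> ring
    have h1 : star (φ true y none) ⬝ᵥ φ true y' none = 1 := star_single_dotProduct_self true
    rw [h1, one_mul, Finset.prod_congr rfl fun t _ => this t, Finset.prod_const, Finset.card_univ,
      Fintype.card_fin, ← Complex.ofReal_pow, hN]
    norm_num
  have hin0 : ∀ y y', star (prodState (φ true y)) ⬝ᵥ prodState (φ false y') = 0 := by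
    intro y y'
    rw [star_prodState_dotProduct, Fintype.prod_option]
    simp [φ]
  obtain ⟨U, hU⟩ := exists_unitary_mulVec (star_single_dotProduct_self false)
    (star_qubitState_dotProduct_self hcs)
  obtain ⟨L, hL, hL'⟩ := exists_realizable_unitaries
    fun q : Option (Fin N) => q.elim 1 fun _ => U
  obtain ⟨Z, hZ, hZψ⟩ := exists_realizable_sign (none : Option (Fin N))
  have hLx : ∀ x, L *ᵥ Pi.single (fun q => q.elim x fun _ => false) 1 =
      prodState (φ x false) := by
    intro x
    rw [single_eq_prodState, hL']
    congr 1
    funext q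
    cases q
    exacts [Matrix.one_mulVec _, hU]
  have hZx : ∀ x y, Z *ᵥ prodState (φ x y) = bitSign x • prodState (φ x y) := by
    intro x y
    rw [hZψ]
    funext w
    simp only [Pi.smul_apply, smul_eq_mul]
    by_cases hw : w none = x
    · simp [hw, bitSign]
    · have : prodState (φ x y) w = 0 :=
        Finset.prod_eq_zero (Finset.mem_univ none) (by simp [φ, hw])
      simp [this]
  -- For `x = 1` the two product states have overlap `1/2`, so the two reflections send the first to
  -- minus the second, and `Z` repairs the sign. For `x = 0` both reflections act trivially by
  -- orthogonality.
  refine ⟨Z * (reflection (prodState (φ true false)) * (reflection (prodState (φ true true)) * L)),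
    hZ.mul ((realizable_reflection_prodState (hφ _ _)).mul
      ((realizable_reflection_prodState (hφ _ _)).mul hL)), fun x => ?_⟩
  rw [← Matrix.mulVec_mulVec, ← Matrix.mulVec_mulVec, ← Matrix.mulVec_mulVec, hLx,
    reflection_mulVec, reflection_mulVec]
  cases x
  · simp only [hin0, mul_zero, zero_smul, sub_zero, hZx, bitSign]
    simp [φ]
  · rw [hin true false (by simp), dotProduct_sub, star_prodState_dotProduct_self (hφ _ _),
      dotProduct_smul, hin false true (by simp), Matrix.mulVec_sub, Matrix.mulVec_sub,
      Matrix.mulVec_smul, Matrix.mulVec_smul, hZx, hZx]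
    funext w
    change _ = prodState (φ true true) w
    simp only [bitSign, Pi.sub_apply, Pi.smul_apply, smul_eq_mul, if_true]
    ring

end Rotation

/-! ### A single test of the Hamming weight. -/

section Test

theorem sum_norm_sq_eq {ι : Type} [Fintype ι] (Φ : ι → ℂ) (h : star Φ ⬝ᵥ Φ = 1) :
    ∑ w, ‖Φ w‖ ^ 2 = 1 := by
  have h1 : star Φ ⬝ᵥ Φ = ((∑ w, ‖Φ w‖ ^ 2 : ℝ) : ℂ) := by
    simp only [dotProduct, Pi.star_apply, RCLike.star_def, Complex.conj_mul', Complex.ofReal_sum,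
      Complex.ofReal_pow]
  rw [h1] at h
  exact_mod_cast h

/-- Rotating `η` to `|1⟩` makes the amplitude of `|1…1⟩` in a rotated product the overlap with the
product of the `η`. -/
theorem mulVec_apply_true {U : Matrix.unitaryGroup Bool ℂ} {η : Bool → ℂ}
    (h : (U : Matrix Bool Bool ℂ) *ᵥ η = Pi.single true 1) (v : Bool → ℂ) :
    ((U : Matrix Bool Bool ℂ) *ᵥ v) true = star η ⬝ᵥ v := by
  have h1 : star ((U : Matrix Bool Bool ℂ) *ᵥ η) ⬝ᵥ ((U : Matrix Bool Bool ℂ) *ᵥ v) =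
      star η ⬝ᵥ v := by
    rw [Matrix.star_mulVec, Matrix.dotProduct_mulVec, Matrix.vecMul_vecMul,
      ← Matrix.star_eq_conjTranspose, Matrix.mem_unitaryGroup_iff'.1 U.2, Matrix.vecMul_one]
  rw [← h1, h]
  simp

/-- The input state of a test. -/
def testState {n : ℕ} (c s : ℝ) (x : Fin n → Bool) : Fin n ⊕ Bool → Bool → ℂ :=
  Sum.elim (fun i => qubitState c (if x i then -s else s)) fun _ => Pi.single false 1

/-- A test whose flag `inr true` ends in state `|0⟩` with amplitude `C^|x| - C^h`. -/
theorem exists_realizable_test {n h : ℕ} {c s ζ : ℝ} (hcs : c ^ 2 + s ^ 2 = 1)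
    (hζ1 : ζ ^ 2 ≤ 1) (hζ : 2 * (c ^ n * ζ) ^ 2 = (c ^ 2 - s ^ 2) ^ h) :
    ∃ T : Matrix (Fin n ⊕ Bool → Bool) (Fin n ⊕ Bool → Bool) ℂ, Realizable 5 T ∧
      ∀ x : Fin n → Bool,
        ∑ w, (if w (Sum.inr true) = true then ‖(T *ᵥ prodState (testState c s x)) w‖ ^ 2 else 0) =
          1 - ((c ^ 2 - s ^ 2) ^ bitWeight x - (c ^ 2 - s ^ 2) ^ h) ^ 2 := by
  have : Nontrivial (Fin n ⊕ Bool) := ⟨⟨Sum.inr true, Sum.inr false, by simp⟩⟩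
  set f : Fin n ⊕ Bool := Sum.inr true with hf
  let η : Fin n ⊕ Bool → Bool → ℂ := Sum.elim (fun _ => qubitState c s) fun _ => qubitState 1 0
  -- The amplitude of `|0^n⟩` is `c ^ n` in every encoding, whatever the signs. So `χ` has the same
  -- overlap `c ^ n * ζ` with the input as with `η`, and reflecting about it subtracts `2 (c ^ n *
  -- ζ)² = C ^ h` from the overlap of the input with `η`; the extra qubit supplies `ζ`.
  let χ : Fin n ⊕ Bool → Bool → ℂ := Sum.elim (fun _ => qubitState 1 0) fun b =>
    if b then qubitState 1 0 else qubitState ζ (√(1 - ζ ^ 2))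
  have h10 : star (qubitState 1 0) ⬝ᵥ qubitState 1 0 = 1 :=
    star_qubitState_dotProduct_self (by norm_num)
  have hη : ∀ q, star (η q) ⬝ᵥ η q = 1 := by
    rintro (i | b)
    exacts [star_qubitState_dotProduct_self hcs, h10]
  have hχ : ∀ q, star (χ q) ⬝ᵥ χ q = 1 := by
    rintro (i | _ | _)
    · exact h10
    · exact star_qubitState_dotProduct_self (by rw [Real.sq_sqrt (by linarith)]; ring)
    · exact h10
  have hψ : ∀ (x : Fin n → Bool) q, star (testState c s x q) ⬝ᵥ testState c s x q = 1 := by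
    rintro x (i | b)
    · refine star_qubitState_dotProduct_self ?_
      split_ifs <;> linarith [neg_sq s]
    · exact star_single_dotProduct_self false
  choose U hU using fun q => exists_unitary_mulVec (hη q) (star_single_dotProduct_self true)
  obtain ⟨L, hL, hL'⟩ := exists_realizable_unitaries U
  set S : Finset (Fin n ⊕ Bool) := Finset.univ.erase f with hS
  have hSne : S.Nonempty := ⟨Sum.inr false, by simp [hS, hf]⟩
  have hfS : f ∉ S := by simp [hS]
  -- After `L` the flag is always `|1⟩`, and the Toffoli gate clears it precisely on the all-ones
  -- string, whose amplitude is the difference of powers.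
  have hT : Realizable 5 ((QACGate.toffoli S hSne f hfS).toMatrix *
      (L * reflection (prodState χ))) :=
    (Realizable.gate _).mul (hL.mul (realizable_reflection_prodState hχ))
  refine ⟨_, hT, fun x => ?_⟩
  have hnorm := sum_norm_sq_eq (_ *ᵥ prodState (testState c s x))
    ((hT.dotProduct_mulVec _ _).trans (star_prodState_dotProduct_self (hψ x)))
  rw [← hnorm, eq_sub_iff_add_eq]
  have hA1 : star (prodState η) ⬝ᵥ prodState (testState c s x) =
      (((c ^ 2 - s ^ 2) ^ bitWeight x : ℝ) : ℂ) := by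
    rw [star_prodState_dotProduct, Fintype.prod_sum_type]
    have h1 : ∀ i, star (η (Sum.inl i)) ⬝ᵥ testState c s x (Sum.inl i) =
        if x i = true then ((c ^ 2 - s ^ 2 : ℝ) : ℂ) else 1 := by
      intro i
      simp only [η, testState, Sum.elim_inl, star_qubitState_dotProduct]
      split_ifs
      · congr 1; ring
      · rw [← Complex.ofReal_one, ← hcs]; congr 1; ring
    have h2 : ∀ b, star (η (Sum.inr b)) ⬝ᵥ testState c s x (Sum.inr b) = 1 := by
      intro b
      simp only [η, testState, Sum.elim_inr, single_false_eq_qubitState, h10]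
    simp only [h1, h2, Finset.prod_const_one, mul_one, Finset.prod_ite, Finset.prod_const,
      bitWeight, Complex.ofReal_pow]
  have hA2 : star (prodState χ) ⬝ᵥ prodState (testState c s x) = ((c ^ n * ζ : ℝ) : ℂ) := by
    rw [star_prodState_dotProduct, Fintype.prod_sum_type]
    simp [χ, testState, single_false_eq_qubitState, star_qubitState_dotProduct]
  have hA3 : star (prodState η) ⬝ᵥ prodState χ = ((c ^ n * ζ : ℝ) : ℂ) := by
    rw [star_prodState_dotProduct, Fintype.prod_sum_type]
    simp [χ, η, star_qubitState_dotProduct]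
  have hval : (L * reflection (prodState χ)) *ᵥ prodState (testState c s x) =
      prodState (fun q => (U q : Matrix Bool Bool ℂ) *ᵥ testState c s x q) -
        (2 * ((c ^ n * ζ : ℝ) : ℂ)) • prodState fun q => (U q : Matrix Bool Bool ℂ) *ᵥ χ q := by
    rw [← Matrix.mulVec_mulVec, reflection_mulVec, Matrix.mulVec_sub, Matrix.mulVec_smul, hL', hL',
      hA2]
  have htrue : ((L * reflection (prodState χ)) *ᵥ prodState (testState c s x)) (fun _ => true) =
      (((c ^ 2 - s ^ 2) ^ bitWeight x - (c ^ 2 - s ^ 2) ^ h : ℝ) : ℂ) := by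
    have hp : ∀ v : Fin n ⊕ Bool → Bool → ℂ, prodState (fun q => (U q : Matrix Bool Bool ℂ) *ᵥ v q)
        (fun _ => true) = star (prodState η) ⬝ᵥ prodState v := by
      intro v
      rw [star_prodState_dotProduct]
      exact Finset.prod_congr rfl fun q _ => mulVec_apply_true (hU q) _
    rw [hval, Pi.sub_apply, Pi.smul_apply, hp, hp, hA1, hA3, ← hζ]
    simp only [smul_eq_mul]
    push_cast
    ring
  have hfalse : ∀ w : Fin n ⊕ Bool → Bool, w f = false →
      ((L * reflection (prodState χ)) *ᵥ prodState (testState c s x)) w = 0 := by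
    intro w hw
    have hp : ∀ v : Fin n ⊕ Bool → Bool → ℂ, v f = η f →
        prodState (fun q => (U q : Matrix Bool Bool ℂ) *ᵥ v q) w = 0 := by
      intro v hv
      refine Finset.prod_eq_zero (Finset.mem_univ f) ?_
      change ((U f : Matrix Bool Bool ℂ) *ᵥ v f) (w f) = 0
      rw [hv, hU, hw]
      simp
    rw [hval, Pi.sub_apply, Pi.smul_apply, hp (testState c s x) single_false_eq_qubitState, hp χ rfl]
    simp
  have hrej : ∑ w : Fin n ⊕ Bool → Bool, (if w f = true then 0 else
      ‖(((QACGate.toffoli S hSne f hfS).toMatrix * (L * reflection (prodState χ))) *ᵥ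
        prodState (testState c s x)) w‖ ^ 2) =
      ((c ^ 2 - s ^ 2) ^ bitWeight x - (c ^ 2 - s ^ 2) ^ h) ^ 2 := by
    rw [← Matrix.mulVec_mulVec, QACGate.toffoli_mulVec,
      Finset.sum_eq_single (Function.update (fun _ => true) f false)]
    · have : QACGate.toffoliMap S f (Function.update (fun _ => true) f false) = fun _ => true := by
        have h1 : ∀ q ∈ S, Function.update (fun _ => true) f false q = true := fun q hq => by
          rw [Function.update_of_ne (Finset.ne_of_mem_erase hq)]
        rw [QACGate.toffoliMap, decide_eq_true h1]
        simp
      beta_reduce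
      rw [this, htrue, if_neg (by simp), Complex.norm_real, Real.norm_eq_abs, sq_abs]
    · intro w _ hw
      split_ifs with hwf
      · rfl
      · have hwf' : w f = false := by simpa using hwf
        have hc : ¬ ∀ q ∈ S, w q = true := by
          intro hc
          apply hw
          funext q
          by_cases hq : q = f
          · rw [hq, hwf', Function.update_self]
          · rw [Function.update_of_ne hq, hc q (by simp [hS, hq])]
        have : QACGate.toffoliMap S f w = w := by
          rw [QACGate.toffoliMap, decide_eq_false hc]
          simp
        beta_reduce
        rw [this, hfalse w hwf']
        simp
    · simp
  rw [← hrej, ← Finset.sum_add_distrib]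
  refine Finset.sum_congr rfl fun w _ => ?_
  split_ifs <;> simp

end Test

/-! ### Conjunction of independent flags. -/

section Flags

variable {Q β : Type} {K : β → Type} [Fintype Q] [DecidableEq Q] [Fintype β] [DecidableEq β]
  [∀ b, Fintype (K b)] [∀ b, DecidableEq (K b)]

/-- The indicator pins every qubit outside the blocks to `u`, so the sum runs over independent
choices in the blocks and factors. -/
theorem sum_prod_blocks {e : ∀ b, K b → Q} (he : Function.Injective fun p : Σ b, K b => e p.1 p.2)
    (g : ∀ b, (K b → Bool) → ℝ) (u : Q → Bool) :
    ∑ w : Q → Bool, ((∏ b, g b (w ∘ e b)) *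
      if ∀ q, (∀ b k, e b k ≠ q) → w q = u q then 1 else 0) = ∏ b, ∑ v, g b v := by
  rw [Finset.prod_univ_sum, Fintype.piFinset_univ]
  symm
  let E : (∀ b, K b → Bool) → Q → Bool := fun p =>
    Function.extend (fun z : Σ b, K b => e z.1 z.2) (fun z => p z.1 z.2) u
  have hE : ∀ p b, E p ∘ e b = p b := fun p b => funext fun k =>
    he.extend_apply (fun z => p z.1 z.2) u ⟨b, k⟩
  have hE' : ∀ p q, (∀ b k, e b k ≠ q) → E p q = u q := fun p q hq =>
    Function.extend_apply' _ _ _ fun ⟨z, hz⟩ => hq z.1 z.2 hz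
  refine Finset.sum_of_injOn E ?_ ?_ ?_ ?_
  · intro p _ p' _ h
    funext b
    rw [← hE p b, ← hE p' b, h]
  · simp
  · intro w _ hw
    rw [if_neg, mul_zero]
    intro h
    refine hw ⟨fun b => w ∘ e b, by simp, funext fun q => ?_⟩
    by_cases hq : ∃ b k, e b k = q
    · obtain ⟨b, k, rfl⟩ := hq
      exact congrFun (hE (fun b => w ∘ e b) b) k
    · push Not at hq
      rw [hE' (fun b => w ∘ e b) q hq, h q hq]
  · intro p _
    rw [if_pos (hE' p), mul_one]
    exact Finset.prod_congr rfl fun b _ => by rw [hE]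

/-- The conjunction of the flags of independent blocks. -/
theorem exists_realizable_and_flags [Nonempty β] {e : ∀ b, K b → Q}
    (he : Function.Injective fun p : Σ b, K b => e p.1 p.2) (f : ∀ b, K b) (out : Q)
    (hout : ∀ b k, e b k ≠ out) :
    ∃ T : Matrix (Q → Bool) (Q → Bool) ℂ, Realizable 1 T ∧
      ∀ (Φ : ∀ b, (K b → Bool) → ℂ) (u : Q → Bool), u out = false →
        ∑ w, (if w out = true then ‖(T *ᵥ fun w => (∏ b, Φ b (w ∘ e b)) *
          if ∀ q, (∀ b k, e b k ≠ q) → w q = u q then 1 else 0) w‖ ^ 2 else 0) =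
        ∏ b, ∑ v, if v (f b) = true then ‖Φ b v‖ ^ 2 else 0 := by
  have hS : (Finset.univ.image fun b => e b (f b)).Nonempty := by simp
  have ht : out ∉ Finset.univ.image fun b => e b (f b) := by
    simpa using fun b => hout b (f b)
  refine ⟨_, Realizable.gate (QACGate.toffoli _ hS out ht), fun Φ u hu => ?_⟩
  rw [QACGate.toffoli_mulVec, ← sum_prod_blocks he _ u]
  have hT := QACGate.toffoliMap_involutive ht
  -- Reindexing by the gate itself returns to the state before it, where `out` is `false`; the
  -- output is then `true` exactly when all flags are.
  rw [← Equiv.sum_comp hT.toPerm]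
  refine Finset.sum_congr rfl fun w _ => ?_
  simp only [Function.Involutive.coe_toPerm, hT w]
  split_ifs with h1 h2 h2
  · have hw : w out = false := by rw [h2 out hout, hu]
    have h3 : ∀ b, w (e b (f b)) = true := by
      simpa [QACGate.toffoliMap, hw] using h1
    simp only [Function.comp_apply, h3, if_true, mul_one, norm_prod, Finset.prod_pow]
  · simp
  · have hw : w out = false := by rw [h2 out hout, hu]
    have h3 : ¬ ∀ b, w (e b (f b)) = true := by
      simpa [QACGate.toffoliMap, hw] using h1
    push Not at h3
    obtain ⟨b, hb⟩ := h3
    rw [Finset.prod_eq_zero (Finset.mem_univ b), zero_mul]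
    rw [if_neg]
    simpa using hb
  · simp

end Flags

/-! ### From matrices on arbitrary registers to circuits with ancillas and an output. -/

section Transport

/-- Qubits that are neither input nor output are enumerated as ancillas. In the size bound, `d`
counts gates per qubit, one for each layer, and the extra `1` counts the qubit itself. -/
theorem exists_circuit_of_realizable {Q : Type} [Fintype Q] [DecidableEq Q] {n d : ℕ}
    {inp : Fin n → Q} (hinp : Function.Injective inp) {out : Q} (hout : ∀ i, inp i ≠ out)
    {M : Matrix (Q → Bool) (Q → Bool) ℂ} (hM : Realizable d M) :
    ∃ (a : ℕ) (C : QACCircuit (QACRegister n a)), C.depth = d ∧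
      C.size ≤ (d + 1) * Fintype.card Q ∧ ∀ x b, C.outputProb x b = ∑ w : Q → Bool,
        if w out = b then ‖(M *ᵥ Pi.single (Function.extend inp x fun _ => false) 1) w‖ ^ 2
        else 0 := by
  classical
  let A : Type := {q : Q // q ≠ out ∧ ∀ i, inp i ≠ q}
  let a := Fintype.card A
  let g : QACRegister n a → Q :=
    Sum.elim inp (Sum.elim (fun k => ((Fintype.equivFin A).symm k).1) fun _ => out)
  have hg : Function.Bijective g := by
    constructor
    · rintro (i | k | _) (j | l | _) h
      · exact congrArg _ (hinp h)
      · exact absurd h (((Fintype.equivFin A).symm l).2.2 i)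
      · exact absurd h (hout i)
      · exact absurd h.symm (((Fintype.equivFin A).symm k).2.2 j)
      · have := (Fintype.equivFin A).symm.injective (Subtype.ext h)
        rw [this]
      · exact absurd h ((Fintype.equivFin A).symm k).2.1
      · exact absurd h.symm (hout j)
      · exact absurd h.symm ((Fintype.equivFin A).symm l).2.1
      · rfl
    · intro q
      by_cases h1 : q = out
      · exact ⟨Sum.inr (Sum.inr ()), h1.symm⟩
      · by_cases h2 : ∃ i, inp i = q
        · exact ⟨Sum.inl h2.choose, h2.choose_spec⟩
        · push Not at h2
          exact ⟨Sum.inr (Sum.inl (Fintype.equivFin A ⟨q, h1, h2⟩)), by simp [g]⟩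
  let σ : QACRegister n a ≃ Q := Equiv.ofBijective g hg
  obtain ⟨N, hN, hN'⟩ := ActsOnBlocks.exists_realizable (β := Unit) (K := fun _ => Q)
    (fun _ => σ.symm) (fun p p' h => by
      cases p; cases p'; simpa using h) (M := fun _ => M) fun _ => hM
  obtain ⟨Ls, hLs, hLN⟩ := hN.exists_layers
  refine ⟨a, ⟨Ls⟩, hLs, ?_, fun x b => ?_⟩
  · rw [QACCircuit.size, ← Fintype.card_congr σ, Nat.add_mul, one_mul, ← hLs]
    refine Nat.add_le_add_right ?_ _
    have := List.sum_le_card_nsmul (Ls.map fun L => L.gates.length)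
      (Fintype.card (QACRegister n a)) (by
        intro m hm
        obtain ⟨L, -, rfl⟩ := List.mem_map.1 hm
        exact L.gates_length_le)
    simpa using this
  · have hinit : QACRegister.init a x ∘ σ.symm = Function.extend inp x fun _ => false := by
      funext q
      obtain ⟨p, rfl⟩ := σ.surjective q
      rw [Function.comp_apply, Equiv.symm_apply_apply]
      rcases p with i | k | _
      · exact (hinp.extend_apply x _ i).symm
      · change false = Function.extend inp x (fun _ => false) ((Fintype.equivFin A).symm k).1
        exact (Function.extend_apply' x (fun _ => false) _ fun ⟨i, hi⟩ =>
          ((Fintype.equivFin A).symm k).2.2 i hi).symm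
      · change false = Function.extend inp x (fun _ => false) out
        exact (Function.extend_apply' x (fun _ => false) _ fun ⟨i, hi⟩ => hout i hi).symm
    rw [QACCircuit.outputProb, ← Equiv.sum_comp (Equiv.arrowCongr σ (Equiv.refl Bool))]
    refine Finset.sum_congr rfl fun y _ => ?_
    have h1 : QACCircuit.run ⟨Ls⟩ (QACRegister.init a x) y =
        (M *ᵥ Pi.single (Function.extend inp x fun _ => false) 1) (y ∘ σ.symm) := by
      rw [QACCircuit.run, QACCircuit.toMatrix, hLN, hN'.mulVec_single]
      simp only [Finset.univ_unique, Finset.prod_singleton, hinit]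
      rw [if_pos, mul_one]
      intro q hq
      exact absurd (σ.symm_apply_apply q) (hq () _)
    rw [h1]
    have h2 : σ.symm out = QACRegister.out n a := by
      rw [Equiv.symm_apply_eq]
      rfl
    simp only [Equiv.arrowCongr_apply, Equiv.coe_refl, Function.comp_apply, id, h2]
    rfl

theorem sum_output_false {Q : Type} [Fintype Q] [DecidableEq Q] {d : ℕ}
    {M : Matrix (Q → Bool) (Q → Bool) ℂ} (hM : Realizable d M) (u : Q → Bool) (out : Q) :
    ∑ w : Q → Bool, (if w out = false then ‖(M *ᵥ Pi.single u 1) w‖ ^ 2 else 0) =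
      1 - ∑ w : Q → Bool, if w out = true then ‖(M *ᵥ Pi.single u 1) w‖ ^ 2 else 0 := by
  rw [← sum_norm_sq_eq (M *ᵥ Pi.single u 1)
    ((hM.dotProduct_mulVec _ _).trans (star_single_dotProduct_self u)), eq_sub_iff_add_eq,
    ← Finset.sum_add_distrib]
  refine Finset.sum_congr rfl fun w _ => ?_
  cases w out <;> simp

end Transport

/-! ### The balance circuit: fan-out, encoding, tests, conjunction. -/

section Assembly

/-- The register of the balance circuit: the fan-out registers of the `n` inputs, the registers of
the tests, and the output. -/
abbrev BalanceRegister (n : ℕ) (V C : Type) : Type :=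
  (Fin n × Option V) ⊕ (((C × Fin n) × (Fin n ⊕ Bool)) ⊕ Unit)

/-- Every stage keeps the inputs and their copies in a basis state, so the tests stay in a product
state and their acceptance probabilities multiply. The depth is `d + 8 + 5 + 1`. -/
theorem exists_realizable_balance {n h d : ℕ} (hn : 1 ≤ n) {V C : Type} [Fintype V]
    [DecidableEq V] [Fintype C] [DecidableEq C] [Nonempty C] (hVC : HasFanOut d V C) {c s ζ : ℝ}
    (hcs : c ^ 2 + s ^ 2 = 1) (hN : (c ^ 2 - s ^ 2) ^ n = 1 / 2) (hζ1 : ζ ^ 2 ≤ 1)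
    (hζ : 2 * (c ^ n * ζ) ^ 2 = (c ^ 2 - s ^ 2) ^ h) :
    ∃ (a : ℕ) (C' : QACCircuit (QACRegister n a)), C'.depth ≤ d + 14 ∧
      C'.size ≤ (d + 15) * (n * (Fintype.card V + 1) + (Fintype.card C * n * (n + 2) + 1)) ∧
      ∀ x, C'.outputProb x true =
          (1 - ((c ^ 2 - s ^ 2) ^ bitWeight x - (c ^ 2 - s ^ 2) ^ h) ^ 2) ^ (Fintype.card C * n) ∧
        C'.outputProb x false = 1 -
          (1 - ((c ^ 2 - s ^ 2) ^ bitWeight x - (c ^ 2 - s ^ 2) ^ h) ^ 2) ^ (Fintype.card C * n) := by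
  have : Nonempty (Fin n) := ⟨⟨0, hn⟩⟩
  obtain ⟨cp, F, hcp, hF, hF'⟩ := hVC
  choose wf hwf hFw using hF'
  obtain ⟨B, hB, hB'⟩ := exists_realizable_controlled_rotation hn hcs hN
  obtain ⟨T, hT, hT'⟩ := exists_realizable_test hcs hζ1 hζ
  let e₀ : Fin n → Option V → BalanceRegister n V C := fun i k => Sum.inl (i, k)
  -- Copy `c` of input `i` controls the `i`-th qubit of the `n` tests `(c, t)`. The index in `Fin n`
  -- names an input here but a test in `e₂`, whence the exchange of products in `h3`.
  let e₁ : C × Fin n → Option (Fin n) → BalanceRegister n V C := fun p k =>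
    k.elim (Sum.inl (p.2, cp p.1)) fun t => Sum.inr (Sum.inl ((p.1, t), Sum.inl p.2))
  let e₂ : C × Fin n → Fin n ⊕ Bool → BalanceRegister n V C := fun p k => Sum.inr (Sum.inl (p, k))
  have he₀ : Function.Injective fun p : Σ _ : Fin n, Option V => e₀ p.1 p.2 := by
    rintro ⟨i, k⟩ ⟨i', k'⟩ h
    simpa [e₀] using h
  have he₁ : Function.Injective fun p : Σ _ : C × Fin n, Option (Fin n) => e₁ p.1 p.2 := by
    rintro ⟨⟨c, i⟩, _ | t⟩ ⟨⟨c', i'⟩, _ | t'⟩ h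
    · have h' : i = i' ∧ cp c = cp c' := by simpa [e₁] using h
      rw [h'.1, hcp h'.2]
    · simp [e₁] at h
    · simp [e₁] at h
    · have h' : (c = c' ∧ t = t') ∧ i = i' := by simpa [e₁] using h
      rw [h'.1.1, h'.1.2, h'.2]
  have he₂ : Function.Injective fun p : Σ _ : C × Fin n, Fin n ⊕ Bool => e₂ p.1 p.2 := by
    rintro ⟨i, k⟩ ⟨i', k'⟩ h
    have h' : i = i' ∧ k = k' := by simpa [e₂] using h
    rw [h'.1, h'.2]
  let out : BalanceRegister n V C := Sum.inr (Sum.inr ())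
  obtain ⟨N₀, hN₀, hN₀'⟩ := ActsOnBlocks.exists_realizable e₀ he₀ (M := fun _ => F) fun _ => hF
  obtain ⟨N₁, hN₁, hN₁'⟩ := ActsOnBlocks.exists_realizable e₁ he₁ (M := fun _ => B) fun _ => hB
  obtain ⟨N₂, hN₂, hN₂'⟩ := ActsOnBlocks.exists_realizable e₂ he₂ (M := fun _ => T) fun _ => hT
  obtain ⟨N₃, hN₃, hN₃'⟩ := exists_realizable_and_flags he₂ (fun _ => Sum.inr true) out
    (fun b k => by simp [e₂, out])
  have hR : Realizable (1 + (5 + (8 + d))) (N₃ * (N₂ * (N₁ * N₀))) :=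
    hN₃.mul (hN₂.mul (hN₁.mul hN₀))
  obtain ⟨a, C', hC1, hC2, hC3⟩ := exists_circuit_of_realizable (inp := fun i : Fin n => e₀ i none)
    (fun i j h => by simpa [e₀] using h) (out := out) (fun i => by simp [e₀, out]) hR
  have hprob : ∀ x : Fin n → Bool, C'.outputProb x true =
      (1 - ((c ^ 2 - s ^ 2) ^ bitWeight x - (c ^ 2 - s ^ 2) ^ h) ^ 2) ^ (Fintype.card C * n) := by
    intro x
    let u : BalanceRegister n V C → Bool := Sum.elim (fun p => wf (x p.1) p.2) fun _ => false
    have h0 : N₀ *ᵥ Pi.single (Function.extend (fun i : Fin n => e₀ i none) x fun _ => false) 1 =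
        Pi.single u 1 := by
      have hin : Function.Injective fun i : Fin n => e₀ i none := fun i j h => by
        simpa [e₀] using h
      refine hN₀'.mulVec_single_eq_single (fun i => ?_) fun q hq => ?_
      · have h1 : u ∘ e₀ i = wf (x i) := rfl
        rw [h1, ← hFw]
        congr 2
        funext k
        cases k with
        | none => exact hin.extend_apply _ _ _
        | some v => exact Function.extend_apply' _ _ _ (by simp [e₀])
      · rcases q with ⟨i, k⟩ | q
        · exact absurd rfl (hq i k)
        · exact (Function.extend_apply' _ _ _ (by simp [e₀])).symm
    have h1 : N₁ *ᵥ Pi.single u 1 = fun w => (∏ b, prodState (testState c s x) (w ∘ e₂ b)) *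
        if ∀ q, (∀ b k, e₂ b k ≠ q) → w q = u q then 1 else 0 := by
      rw [hN₁'.mulVec_single]
      have hu : ∀ b : C × Fin n, u ∘ e₁ b = fun q => q.elim (x b.2) fun _ => false := by
        intro b
        funext q
        cases q with
        | none => exact hwf _ _
        | some t => rfl
      simp only [hu, hB']
      funext w
      have h3 : (∏ b : C × Fin n, ∏ t : Fin n, qubitState c (if x b.2 = true then -s else s)
          (w (Sum.inr (Sum.inl ((b.1, t), Sum.inl b.2))))) =
          ∏ b : C × Fin n, ∏ i : Fin n, qubitState c (if x i = true then -s else s)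
            (w (Sum.inr (Sum.inl (b, Sum.inl i)))) := by
        rw [Fintype.prod_prod_type, Fintype.prod_prod_type]
        exact Finset.prod_congr rfl fun _ _ => Finset.prod_comm
      have h4 : (∏ b : C × Fin n, prodState (fun q => q.elim (Pi.single (x b.2) 1)
          fun _ => qubitState c (if x b.2 = true then -s else s)) (w ∘ e₁ b)) =
          (∏ b : C × Fin n, ∏ i : Fin n, qubitState c (if x i = true then -s else s)
            (w (Sum.inr (Sum.inl (b, Sum.inl i))))) *
          if ∀ b : C × Fin n, w (Sum.inl (b.2, cp b.1)) = x b.2 then 1 else 0 := by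
        simp only [prodState, Fintype.prod_option, Finset.prod_mul_distrib]
        rw [mul_comm, ← h3]
        congr 1
        simp only [Option.elim, Pi.single_apply, Finset.prod_ite_zero, Finset.prod_const_one,
          Finset.mem_univ, true_imp_iff]
        rfl
      have h5 : (∏ b : C × Fin n, prodState (testState c s x) (w ∘ e₂ b)) =
          (∏ b : C × Fin n, ∏ i : Fin n, qubitState c (if x i = true then -s else s)
            (w (Sum.inr (Sum.inl (b, Sum.inl i))))) *
          if ∀ (b : C × Fin n) (k : Bool), w (Sum.inr (Sum.inl (b, Sum.inr k))) = false
            then 1 else 0 := by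
        simp only [prodState, Fintype.prod_sum_type, Finset.prod_mul_distrib]
        congr 1
        simp only [testState, Sum.elim_inr, Pi.single_apply, Finset.prod_ite_zero,
          Finset.prod_const_one, Finset.mem_univ, true_imp_iff]
        rfl
      rw [h4, h5, mul_assoc, mul_assoc]
      congr 1
      simp only [mul_ite, mul_one, mul_zero, ← ite_and]
      congr 1
      rw [eq_iff_iff]
      constructor
      · rintro ⟨hoff, hcop⟩
        refine ⟨?_, ?_⟩
        · rintro (⟨i, k⟩ | p | _) hq
          · by_cases hk : ∃ c, cp c = k
            · obtain ⟨c, rfl⟩ := hk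
              exact (hcop (c, i)).trans (hwf _ _).symm
            · push Not at hk
              refine hoff _ fun b k' => ?_
              rcases k' with _ | t
              · intro h
                have h' : b.2 = i ∧ cp b.1 = k := by simpa [e₁] using h
                exact hk _ h'.2
              · simp [e₁]
          · exact absurd rfl (hq p.1 p.2)
          · refine hoff _ fun b k' => ?_
            rcases k' with _ | t <;> simp [e₁]
        · intro b k
          refine hoff _ fun b k' => ?_
          rcases k' with _ | t <;> simp [e₁]
      · rintro ⟨hoff, hflag⟩
        refine ⟨?_, fun b => (hoff _ fun b k => by simp [e₂]).trans (hwf _ _)⟩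
        rintro (⟨i, k⟩ | ⟨p, i | k⟩ | _) hq
        · exact hoff _ fun b k => by simp [e₂]
        · exact absurd rfl (hq (p.1, i) (some p.2))
        · exact hflag p k
        · exact hoff _ fun b k => by simp [e₂]
    rw [hC3]
    simp only [← Matrix.mulVec_mulVec]
    rw [h0, h1, hN₂', hN₃']
    · simp only [hT', Finset.prod_const, Finset.card_univ, Fintype.card_prod, Fintype.card_fin]
    · rfl
    · intro w b k c
      congr 1
      rw [eq_iff_iff]
      refine forall₂_congr fun q hq => ?_
      rw [Function.update_of_ne (hq b k).symm]
  refine ⟨a, C', by omega, ?_, fun x => ⟨hprob x, ?_⟩⟩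
  · refine hC2.trans (Nat.mul_le_mul (by omega) (le_of_eq ?_))
    simp
  · rw [← hprob, hC3, hC3]
    exact sum_output_false hR _ _

end Assembly

/-! ### Circuits for arbitrary Boolean functions, without size bounds. -/

section TruthTable

theorem exists_not_gate : ∃ U : Matrix.unitaryGroup Bool ℂ,
    ∀ b, (U : Matrix Bool Bool ℂ) *ᵥ Pi.single b 1 = Pi.single (!b) 1 := by
  refine ⟨⟨Matrix.of fun i j => if i = !j then 1 else 0, ?_⟩, fun b => ?_⟩
  · rw [Matrix.mem_unitaryGroup_iff]
    ext i j
    cases i <;> cases j <;> simp [Matrix.mul_apply, Matrix.star_apply]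
  · funext i
    cases b <;> cases i <;> simp

theorem exists_realizable_flips {Q : Type} [Fintype Q] [DecidableEq Q] (y : Q → Bool) :
    ∃ M : Matrix (Q → Bool) (Q → Bool) ℂ, Realizable 1 M ∧
      ∀ v : Q → Bool, M *ᵥ Pi.single v 1 = Pi.single (fun q => xor (v q) (y q)) 1 := by
  obtain ⟨U, hU⟩ := exists_not_gate
  obtain ⟨M, hM, hM'⟩ := exists_realizable_unitaries fun q : Q => if y q then U else 1
  refine ⟨M, hM, fun v => ?_⟩
  rw [single_eq_prodState, hM', single_eq_prodState]
  congr 1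
  funext q
  cases y q
  · rw [Bool.xor_false]
    exact Matrix.one_mulVec _
  · rw [Bool.xor_true]
    exact hU _

theorem toffoli_mulVec_single {Q : Type} [Fintype Q] [DecidableEq Q] (S : Finset Q)
    (hS : S.Nonempty) (t : Q) (ht : t ∉ S) (u : Q → Bool) :
    (QACGate.toffoli S hS t ht).toMatrix *ᵥ Pi.single u 1 =
      Pi.single (QACGate.toffoliMap S t u) 1 := by
  rw [QACGate.toffoli_mulVec]
  funext w
  simp only [Pi.single_apply]
  congr 1
  exact propext (QACGate.toffoliMap_involutive ht).eq_iff

/-- Accepted strings are added one at a time: flips turn the string `y` into all ones, and a Toffoli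
gate then toggles the output. A Toffoli gate needs a control, so `n = 0` is treated separately. -/
theorem exists_realizable_function (n : ℕ) (g : (Fin n → Bool) → Bool) :
    ∃ (d : ℕ) (M : Matrix (Option (Fin n) → Bool) (Option (Fin n) → Bool) ℂ), Realizable d M ∧
      ∀ (b : Bool) (x : Fin n → Bool), M *ᵥ Pi.single (fun q => q.elim b x) 1 =
        Pi.single (fun q => q.elim (xor b (g x)) x) 1 := by
  rcases Nat.eq_zero_or_pos n with rfl | hn
  · obtain ⟨M, hM, hM'⟩ := exists_realizable_flips
      fun q : Option (Fin 0) => q.elim (g default) fun _ => false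
    refine ⟨1, M, hM, fun b x => ?_⟩
    rw [hM']
    congr 1
    funext q
    rcases q with _ | i
    · simp only [Option.elim]
      rw [Subsingleton.elim x default]
    · exact i.elim0
  have key : ∀ S : Finset (Fin n → Bool), ∃ (d : ℕ)
      (M : Matrix (Option (Fin n) → Bool) (Option (Fin n) → Bool) ℂ), Realizable d M ∧
      ∀ (b : Bool) (x : Fin n → Bool), M *ᵥ Pi.single (fun q => q.elim b x) 1 =
        Pi.single (fun q => q.elim (xor b (decide (x ∈ S))) x) 1 := by
    intro S
    induction S using Finset.induction_on with
    | empty => exact ⟨0, 1, Realizable.one 0, fun b x => by rw [Matrix.one_mulVec]; simp⟩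
    | insert y S hy ih =>
      obtain ⟨d, M, hM, hM'⟩ := ih
      obtain ⟨A, hA, hA'⟩ := exists_realizable_flips
        fun q : Option (Fin n) => q.elim false fun i => !(y i)
      have hS : (Finset.univ.erase (none : Option (Fin n))).Nonempty := ⟨some ⟨0, hn⟩, by simp⟩
      refine ⟨1 + (1 + (1 + d)), A * ((QACGate.toffoli _ hS none (by simp)).toMatrix * (A * M)),
        hA.mul ((Realizable.gate _).mul (hA.mul hM)), fun b x => ?_⟩
      rw [← Matrix.mulVec_mulVec, ← Matrix.mulVec_mulVec, ← Matrix.mulVec_mulVec, hM', hA',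
        toffoli_mulVec_single, hA']
      congr 1
      funext q
      rcases q with _ | i
      · have h1 : (∀ s ∈ Finset.univ.erase (none : Option (Fin n)),
            xor (s.elim (xor b (decide (x ∈ S))) x) (s.elim false fun i => !(y i)) = true) ↔
            x = y := by
          simp [Option.forall, funext_iff]
        rw [QACGate.toffoliMap, Function.update_self]
        by_cases hx : x = y
        · rw [decide_eq_true (h1.2 hx)]
          subst hx
          simp [hy]
        · rw [decide_eq_false (mt h1.1 hx)]
          simp [hx]
      · simp [QACGate.toffoliMap]
  obtain ⟨d, M, hM, hM'⟩ := key (Finset.univ.filter fun x => g x = true)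
  exact ⟨d, M, hM, fun b x => by rw [hM']; simp⟩

/-- Every Boolean function has a circuit. -/
theorem exists_circuit_of_function (n : ℕ) (g : (Fin n → Bool) → Bool) :
    ∃ (a : ℕ) (C : QACCircuit (QACRegister n a)), ∀ x, C.outputProb x (g x) = 1 := by
  obtain ⟨d, M, hM, hM'⟩ := exists_realizable_function n g
  obtain ⟨a, C, -, -, hC⟩ := exists_circuit_of_realizable (inp := (some : Fin n → Option (Fin n)))
    (Option.some_injective _) (out := none) (by simp) hM
  refine ⟨a, C, fun x => ?_⟩
  have h : Function.extend some x (fun _ => false) = fun q : Option (Fin n) => q.elim false x := by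
    funext q
    cases q with
    | none => exact Function.extend_apply' _ _ _ (by simp)
    | some i => exact (Option.some_injective _).extend_apply _ _ i
  rw [hC, h, hM', Finset.sum_eq_single fun q => q.elim (xor false (g x)) x]
  · simp
  · intro w _ hw
    rw [Pi.single_eq_of_ne hw]
    simp
  · simp

theorem exists_circuit_output_false (n : ℕ) :
    ∃ (a : ℕ) (C : QACCircuit (QACRegister n a)), C.depth = 0 ∧ C.size ≤ n + 1 ∧
      ∀ x, C.outputProb x false = 1 := by
  obtain ⟨a, C, hd, hs, hC⟩ := exists_circuit_of_realizable
    (inp := (some : Fin n → Option (Fin n))) (Option.some_injective _) (out := none) (by simp)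
    (Realizable.one 0)
  refine ⟨a, C, hd, by simpa using hs, fun x => ?_⟩
  rw [hC, Matrix.one_mulVec, Finset.sum_eq_single (Function.extend some x fun _ => false)]
  · rw [Function.extend_apply' _ _ _ (by simp)]
    simp
  · intro w _ hw
    rw [Pi.single_eq_of_ne hw]
    simp
  · simp

end TruthTable

/-! ### Choice of the parameters and estimates of the rejection probability. -/

section Numerics

/-- With `C = 2^(-1/n)` and `c² = (1 + C)/2`, the requirement `ζ² ≤ 1` follows from `C ≤ ((1 +
C)/2)²`, the inequality of means. -/
theorem exists_balance_parameters {n h : ℕ} (hn : 1 ≤ n) (hh : n = h + h) :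
    ∃ c s ζ : ℝ, c ^ 2 + s ^ 2 = 1 ∧ (c ^ 2 - s ^ 2) ^ n = 1 / 2 ∧ ζ ^ 2 ≤ 1 ∧
      2 * (c ^ n * ζ) ^ 2 = (c ^ 2 - s ^ 2) ^ h ∧ 0 < c ^ 2 - s ^ 2 ∧ c ^ 2 - s ^ 2 < 1 := by
  obtain ⟨D, hD1, hDn, -⟩ := exists_pow_eq_two hn
  set C : ℝ := D⁻¹ with hC
  have hC0 : 0 < C := by positivity
  have hC1 : C < 1 := inv_lt_one_of_one_lt₀ hD1
  have hCn : C ^ n = 1 / 2 := by rw [hC, inv_pow, hDn, one_div]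
  have hc : (√((1 + C) / 2)) ^ 2 = (1 + C) / 2 := Real.sq_sqrt (by linarith)
  have hs : (√((1 - C) / 2)) ^ 2 = (1 - C) / 2 := Real.sq_sqrt (by linarith)
  have hcs : (√((1 + C) / 2)) ^ 2 - (√((1 - C) / 2)) ^ 2 = C := by rw [hc, hs]; ring
  have hcn : ((√((1 + C) / 2)) ^ n) ^ 2 = (((1 + C) / 2) ^ 2) ^ h := by
    rw [← pow_mul, mul_comm, pow_mul, hc, ← pow_mul, hh]
    congr 1
    omega
  have hle : C ^ h ≤ (((1 + C) / 2) ^ 2) ^ h :=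
    pow_le_pow_left₀ hC0.le (by nlinarith [sq_nonneg (1 - C)]) h
  have hpos : 0 < (((1 + C) / 2) ^ 2) ^ h := by positivity
  have hζ : (√(C ^ h / (2 * (((1 + C) / 2) ^ 2) ^ h))) ^ 2 =
      C ^ h / (2 * (((1 + C) / 2) ^ 2) ^ h) := Real.sq_sqrt (by positivity)
  refine ⟨√((1 + C) / 2), √((1 - C) / 2), √(C ^ h / (2 * (((1 + C) / 2) ^ 2) ^ h)), ?_, ?_, ?_,
    ?_, ?_, ?_⟩
  · rw [hc, hs]; ring
  · rw [hcs, hCn]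
  · rw [hζ]
    refine div_le_one_of_le₀ ?_ (by positivity)
    linarith
  · rw [hcs, mul_pow, hcn, hζ]
    field_simp
  · rw [hcs]; exact hC0
  · rw [hcs]; exact hC1

/-- Powers of `C` up to `n` are at least `1/2`, and Bernoulli gives `1 - C ≥ 1/(2n)`, so distinct
powers differ by at least `1/(4n)`. -/
theorem le_sq_pow_sub_pow {C : ℝ} (hC0 : 0 < C) (hC1 : C < 1) {n q h : ℕ} (hn : 1 ≤ n)
    (hCn : C ^ n = 1 / 2) (hq : q ≤ n) (hh : h ≤ n) (hqh : q ≠ h) :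
    1 / (16 * (n : ℝ) ^ 2) ≤ (C ^ q - C ^ h) ^ 2 := by
  have hn0 : (0 : ℝ) < n := by exact_mod_cast hn
  have hb : 1 / (2 * n) ≤ 1 - C := by
    have := one_add_mul_le_pow (a := C - 1) (by linarith) n
    rw [add_sub_cancel, hCn] at this
    rw [div_le_iff₀ (by positivity)]
    nlinarith
  have key : ∀ i j : ℕ, i < j → i ≤ n → 1 / (4 * (n : ℝ)) ≤ C ^ i - C ^ j := by
    intro i j hij hi
    have h1 : C ^ j ≤ C ^ (i + 1) := pow_le_pow_of_le_one hC0.le hC1.le hij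
    have h2 : 1 / 2 ≤ C ^ i := hCn ▸ pow_le_pow_of_le_one hC0.le hC1.le hi
    have h3 : 1 / 2 * (1 / (2 * (n : ℝ))) ≤ C ^ i * (1 - C) := by gcongr
    calc 1 / (4 * (n : ℝ)) = 1 / 2 * (1 / (2 * (n : ℝ))) := by field_simp; norm_num
      _ ≤ C ^ i * (1 - C) := h3
      _ = C ^ i - C ^ (i + 1) := by ring
      _ ≤ _ := by linarith
  have h16 : 1 / (16 * (n : ℝ) ^ 2) = (1 / (4 * (n : ℝ))) ^ 2 := by
    field_simp; norm_num
  rw [h16]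
  rcases lt_or_gt_of_ne hqh with h1 | h1
  · exact pow_le_pow_left₀ (by positivity) (key q h h1 hq) 2
  · rw [← neg_sq (C ^ q - C ^ h), neg_sub]
    exact pow_le_pow_left₀ (by positivity) (key h q h1 hh) 2

/-- Bernoulli for `(1 + ε) ^ T` and `(1 - ε)(1 + ε) ≤ 1` bound `(1 - ε) ^ T` by `1/(1 + Tε)`. -/
theorem le_one_sub_one_sub_pow {ε a : ℝ} (hε : 0 ≤ ε) (ha : ε ≤ a) (ha1 : a ≤ 1) (T : ℕ) :
    T * ε / (1 + T * ε) ≤ 1 - (1 - a) ^ T := by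
  have hT : 0 ≤ (T : ℝ) * ε := by positivity
  have h1 : (1 - a) ^ T ≤ (1 - ε) ^ T := pow_le_pow_left₀ (by linarith) (by linarith) T
  have h2 : (1 - ε) ^ T * (1 + T * ε) ≤ 1 := by
    have h3 : 1 + T * ε ≤ (1 + ε) ^ T := one_add_mul_le_pow (by linarith) T
    calc (1 - ε) ^ T * (1 + T * ε) ≤ (1 - ε) ^ T * (1 + ε) ^ T :=
          mul_le_mul_of_nonneg_left h3 (pow_nonneg (by linarith) T)
      _ = (1 - ε ^ 2) ^ T := by rw [← mul_pow]; ring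
      _ ≤ 1 := pow_le_one₀ (by nlinarith) (by nlinarith)
  have h4 : (1 - ε) ^ T ≤ 1 / (1 + T * ε) := by
    rwa [le_div_iff₀ (by linarith)]
  have h5 : T * ε / (1 + T * ε) = 1 - 1 / (1 + T * ε) := by
    field_simp
    ring
  rw [h5]
  linarith

theorem eventually_logb_pow_div_le (c : ℕ) :
    ∀ᶠ n : ℕ in Filter.atTop, Real.logb 2 n ^ c / n ≤ 1 / 2 := by
  have hl2 : 0 < Real.log 2 := Real.log_pos (by norm_num)
  have h := ((Real.isLittleO_pow_log_id_atTop (n := c)).comp_tendsto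
    tendsto_natCast_atTop_atTop).bound (show 0 < Real.log 2 ^ c / 2 by positivity)
  filter_upwards [h, Filter.eventually_ge_atTop 1] with n hn hn1
  have hn0 : (0 : ℝ) < n := by exact_mod_cast hn1
  simp only [Function.comp_apply, id, Real.norm_eq_abs] at hn
  rw [abs_of_pos hn0] at hn
  have := (le_abs_self _).trans hn
  rw [Real.logb, div_pow, div_le_iff₀ hn0, div_le_iff₀ (by positivity)]
  linarith

/-- Rounding leaves `log n ≤ (r + 1)² ≤ r⁴`; one further factor `r ≥ 32` absorbs the constant. This
is why `4c + 1` rounds of fan-out are used. -/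
theorem logb_pow_le {n r c : ℕ} (hr : r = Nat.sqrt (Nat.log 2 n)) (hr32 : 32 ≤ r) :
    32 * Real.logb 2 n ^ c ≤ (r : ℝ) ^ (4 * c + 1) := by
  have hr0 : (32 : ℝ) ≤ r := by exact_mod_cast hr32
  have hn0 : n ≠ 0 := by
    rintro rfl
    simp at hr
    omega
  have hn1 : (1 : ℝ) ≤ n := by exact_mod_cast Nat.one_le_iff_ne_zero.2 hn0
  have h0 : 0 ≤ Real.logb 2 n := Real.logb_nonneg (by norm_num) hn1
  have h1 : Real.logb 2 n ≤ (r : ℝ) ^ 4 := by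
    have h2 : n < 2 ^ (Nat.log 2 n + 1) := Nat.lt_pow_succ_log_self (by norm_num) n
    have h3 : Nat.log 2 n + 1 ≤ (r + 1) * (r + 1) := by
      rw [hr]; exact Nat.lt_succ_sqrt _
    have h4 : (n : ℝ) ≤ 2 ^ ((Nat.log 2 n + 1 : ℕ) : ℝ) := by
      rw [Real.rpow_natCast]; exact_mod_cast h2.le
    have h5 : Real.logb 2 n ≤ ((Nat.log 2 n + 1 : ℕ) : ℝ) := by
      rwa [Real.logb_le_iff_le_rpow (by norm_num) (by linarith)]
    have h6 : ((Nat.log 2 n + 1 : ℕ) : ℝ) ≤ (r + 1) * (r + 1) := by exact_mod_cast h3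
    have h7 : (r : ℝ) + 1 ≤ r ^ 2 := by nlinarith
    calc _ ≤ ((r : ℝ) + 1) * (r + 1) := h5.trans h6
      _ ≤ r ^ 2 * r ^ 2 := by gcongr
      _ = _ := by ring
  calc 32 * Real.logb 2 n ^ c ≤ r * ((r : ℝ) ^ 4) ^ c := by gcongr
    _ = _ := by rw [← pow_mul]; ring

end Numerics

/-! ### Small, odd and large even `n`. -/

section Main

/-- `C` accepts all balanced inputs with certainty and rejects the unbalanced ones with probability
at least `min 1 p`. -/
def TestsBalance {n a : ℕ} (C : QACCircuit (QACRegister n a)) (p : ℝ) : Prop :=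
  (∀ x : Fin n → Bool, 2 * bitWeight x = n → C.outputProb x true = 1) ∧
    ∀ x : Fin n → Bool, 2 * bitWeight x ≠ n → min 1 p ≤ C.outputProb x false

theorem bitWeight_le {n : ℕ} (x : Fin n → Bool) : bitWeight x ≤ n :=
  (Finset.card_le_univ _).trans_eq (Fintype.card_fin n)

theorem exists_testsBalance (n : ℕ) (p : ℝ) :
    ∃ (a : ℕ) (C : QACCircuit (QACRegister n a)), TestsBalance C p := by
  obtain ⟨a, C, hC⟩ := exists_circuit_of_function n fun x => decide (2 * bitWeight x = n)
  refine ⟨a, C, fun x hx => ?_, fun x hx => ?_⟩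
  · simpa [hx] using hC x
  · have := hC x
    rw [decide_eq_false hx] at this
    exact this ▸ min_le_left _ _

theorem exists_testsBalance_of_lt (p : ℕ → ℝ) (m : ℕ) : ∃ d S : ℕ, ∀ n < m,
    ∃ (a : ℕ) (C : QACCircuit (QACRegister n a)),
      C.depth ≤ d ∧ C.size ≤ S ∧ TestsBalance C (p n) := by
  choose a C hC using fun n => exists_testsBalance n (p n)
  -- Sums serve as bounds for finitely many circuits at once.
  refine ⟨∑ n ∈ Finset.range m, (C n).depth, ∑ n ∈ Finset.range m, (C n).size,
    fun n hn => ⟨a n, C n, ?_, ?_, hC n⟩⟩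
  · exact Finset.single_le_sum (f := fun n => (C n).depth) (fun _ _ => Nat.zero_le _)
      (Finset.mem_range.2 hn)
  · exact Finset.single_le_sum (f := fun n => (C n).size) (fun _ _ => Nat.zero_le _)
      (Finset.mem_range.2 hn)

theorem exists_testsBalance_of_odd {n : ℕ} (hn : ¬ Even n) (p : ℝ) :
    ∃ (a : ℕ) (C : QACCircuit (QACRegister n a)),
      C.depth = 0 ∧ C.size ≤ n + 1 ∧ TestsBalance C p := by
  obtain ⟨a, C, hd, hs, hC⟩ := exists_circuit_output_false n
  exact ⟨a, C, hd, hs, fun x hx => (hn (hx ▸ even_two_mul _)).elim,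
    fun x _ => (min_le_left _ _).trans_eq (hC x).symm⟩

theorem card_fanOut_le {n r k v : ℕ} (hr : r ≤ n) (hM : r ^ r ≤ n)
    (hv : v ≤ k * r ^ k * (r + r ^ r * (r + 1))) : v ≤ k * n ^ k * (n + n * (n + 1)) :=
  hv.trans (by gcongr)

/-- Because `r² ≤ log n`, the number `r ^ r` of rows is at most `n`, which keeps the fan-out
ancillas polynomial. The `r ^ k` copies of each bit feed `r ^ k * n` tests, each rejecting an
unbalanced input with probability at least `1/(16 n²)`. -/
theorem exists_testsBalance_of_even {c n h : ℕ} (hn : n = h + h)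
    (hr : 32 ≤ Nat.sqrt (Nat.log 2 n)) (hp : Real.logb 2 n ^ c / n ≤ 1 / 2) :
    ∃ (a : ℕ) (C : QACCircuit (QACRegister n a)), C.depth ≤ 60 * (4 * c + 1) + 14 ∧
      C.size ≤ (60 * (4 * c + 1) + 15) *
        (n * ((4 * c + 1) * n ^ (4 * c + 1) * (n + n * (n + 1)) + 1) +
          (n ^ (4 * c + 1) * n * (n + 2) + 1)) ∧
      TestsBalance C (Real.logb 2 n ^ c / n) := by
  obtain ⟨r, hr'⟩ : ∃ r, r = Nat.sqrt (Nat.log 2 n) := ⟨_, rfl⟩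
  obtain ⟨k, hk⟩ : ∃ k, k = 4 * c + 1 := ⟨_, rfl⟩
  rw [← hk]
  rw [← hr'] at hr
  have hn0 : n ≠ 0 := by
    rintro rfl
    simp at hr'
    omega
  have hn1 : 1 ≤ n := Nat.one_le_iff_ne_zero.2 hn0
  have hM : r ^ r ≤ n := calc
    r ^ r ≤ (2 ^ r) ^ r := Nat.pow_le_pow_left Nat.lt_two_pow_self.le r
    _ = 2 ^ (r * r) := (pow_mul _ _ _).symm
    _ ≤ 2 ^ Nat.log 2 n :=
      Nat.pow_le_pow_right (by norm_num) (by rw [hr']; exact Nat.sqrt_le _)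
    _ ≤ n := Nat.pow_log_le_self 2 hn0
  have hrn : r ≤ n := (Nat.le_self_pow (by omega) r).trans hM
  have : Nonempty (Fin r) := ⟨⟨0, by omega⟩⟩
  obtain ⟨V, K, _, _, _, _, hK, hV, hF⟩ :=
    (hasFanOut_base (r := r) (M := r ^ r) (by omega) le_rfl).iterate k
  simp only [Fintype.card_fin, Fintype.card_sum, Fintype.card_prod, Fintype.card_option] at hK hV
  have : Nonempty K := Fintype.card_pos_iff.1 (by rw [hK]; positivity)
  obtain ⟨α, β, ζ, hαβ, hN, hζ1, hζ, h0, h1⟩ := exists_balance_parameters hn1 hn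
  obtain ⟨a, C, hd, hs, hC⟩ := exists_realizable_balance hn1 hF hαβ hN hζ1 hζ
  have hKn : Fintype.card K ≤ n ^ k := hK ▸ Nat.pow_le_pow_left hrn k
  have hVn := card_fanOut_le hrn hM hV
  refine ⟨a, C, hd, hs.trans ?_, fun x hx => ?_, fun x hx => ?_⟩
  · gcongr
  · have hx' : bitWeight x = h := by omega
    rw [(hC x).1, hx']
    simp
  · have hx' : bitWeight x ≠ h := by omega
    rw [(hC x).2]
    have hn' : (0 : ℝ) < n := by exact_mod_cast hn1
    have hA := le_sq_pow_sub_pow h0 h1 hn1 hN (bitWeight_le x) (show h ≤ n by omega) hx'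
    have hA1 : ((α ^ 2 - β ^ 2) ^ bitWeight x - (α ^ 2 - β ^ 2) ^ h) ^ 2 ≤ 1 := by
      have e1 := pow_le_one₀ (n := bitWeight x) h0.le h1.le
      have e2 := pow_le_one₀ (n := h) h0.le h1.le
      have e3 := pow_pos h0 (bitWeight x)
      have e4 := pow_pos h0 h
      rw [sq_le_one_iff_abs_le_one, abs_le]
      constructor <;> linarith
    refine le_trans ?_ (le_one_sub_one_sub_pow (by positivity) hA hA1 _)
    refine (min_le_right _ _).trans ?_
    have hL := logb_pow_le (c := c) hr' hr
    rw [← hk] at hL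
    set p := Real.logb 2 n ^ c / n with hp'
    have hp0 : 0 ≤ p := div_nonneg
      (pow_nonneg (Real.logb_nonneg (by norm_num) (by exact_mod_cast hn1)) c) hn'.le
    have hy : 2 * p ≤ ((Fintype.card K * n : ℕ) : ℝ) * (1 / (16 * (n : ℝ) ^ 2)) := by
      rw [hK]
      push_cast
      have : (r : ℝ) ^ k * n * (1 / (16 * (n : ℝ) ^ 2)) = (r : ℝ) ^ k / 16 / n := by
        field_simp
      rw [this, hp', ← mul_div_assoc]
      gcongr
      linarith
    -- For `y ≥ 2p` and `p ≤ 1/2` one has `y (1 - p) ≥ y/2 ≥ p`, that is, `p ≤ y/(1 + y)`.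
    rw [le_div_iff₀ (by linarith)]
    nlinarith

theorem exists_testsBalance_of_large (c : ℕ) : ∃ m : ℕ, ∀ n ≥ m,
    32 ≤ Nat.sqrt (Nat.log 2 n) ∧ Real.logb 2 n ^ c / n ≤ 1 / 2 := by
  obtain ⟨m, hm⟩ := Filter.eventually_atTop.1 (eventually_logb_pow_div_le c)
  obtain ⟨t, ht⟩ : ∃ t, 32 * 32 ≤ t := ⟨_, le_rfl⟩
  refine ⟨max m (2 ^ t), fun n hn => ⟨?_, hm n (le_of_max_le_left hn)⟩⟩
  exact Nat.le_sqrt.2 (ht.trans (Nat.le_log_of_pow_le (by norm_num) (le_of_max_le_right hn)))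

end Main

end

theorem theoremC1 (c₁ c₂ : ℕ) :
    ∃ (d : ℕ) (P : Polynomial ℕ), ∀ n : ℕ,
      ∃ (a : ℕ) (C : QACCircuit (QACRegister n a)),
        C.depth ≤ d ∧ C.size ≤ P.eval n ∧
        (∀ x : Fin n → Bool, (bitWeight x : ℝ) = (n : ℝ) / 2 →
          1 - (2 : ℝ) ^ (-((Real.logb 2 (n : ℝ)) ^ c₁) : ℝ) ≤ C.outputProb x true) ∧
        (∀ x : Fin n → Bool, (bitWeight x : ℝ) ≠ (n : ℝ) / 2 →
          min 1 ((Real.logb 2 (n : ℝ)) ^ c₂ / (n : ℝ)) ≤ C.outputProb x false) := by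
  obtain ⟨m, hm⟩ := exists_testsBalance_of_large c₂
  obtain ⟨d₀, S₀, h₀⟩ := exists_testsBalance_of_lt (fun n => Real.logb 2 n ^ c₂ / n) m
  let k := 4 * c₂ + 1
  let X : Polynomial ℕ := Polynomial.X
  refine ⟨max d₀ (60 * k + 14), Polynomial.C S₀ + (X + 1) + Polynomial.C (60 * k + 15) *
    (X * (Polynomial.C k * X ^ k * (X + X * (X + 1)) + 1) +
      (X ^ k * X * (X + Polynomial.C 2) + 1)), fun n => ?_⟩
  obtain ⟨a, C, hd, hs, hC⟩ : ∃ (a : ℕ) (C : QACCircuit (QACRegister n a)),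
      C.depth ≤ max d₀ (60 * k + 14) ∧ C.size ≤ S₀ + (n + 1) + (60 * k + 15) *
        (n * (k * n ^ k * (n + n * (n + 1)) + 1) + (n ^ k * n * (n + 2) + 1)) ∧
      TestsBalance C (Real.logb 2 n ^ c₂ / n) := by
    rcases lt_or_ge n m with hn | hn
    · obtain ⟨a, C, hd, hs, hC⟩ := h₀ n hn
      exact ⟨a, C, le_max_of_le_left hd, by rw [add_assoc]; exact le_add_right hs, hC⟩
    · by_cases he : Even n
      · obtain ⟨h, hh⟩ := he
        obtain ⟨a, C, hd, hs, hC⟩ := exists_testsBalance_of_even hh (hm n hn).1 (hm n hn).2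
        exact ⟨a, C, le_max_of_le_right hd, le_add_left hs, hC⟩
      · obtain ⟨a, C, hd, hs, hC⟩ := exists_testsBalance_of_odd he (Real.logb 2 n ^ c₂ / n)
        exact ⟨a, C, hd ▸ Nat.zero_le _, le_add_right (le_add_left hs), hC⟩
  refine ⟨a, C, hd, by simpa [X] using hs, fun x hx => ?_, fun x hx => hC.2 x fun hx' => hx ?_⟩
  -- Acceptance is certain here, so any positive error term suffices.
  · rw [hC.1 x (by rify; linarith)]
    linarith [Real.rpow_pos_of_pos (show (0 : ℝ) < 2 by norm_num) (-(Real.logb 2 n ^ c₁))]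
  · rify at hx'
    linarith
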